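/- Conventions. For a map $f:X\to Y$ between metric spaces and $\delta\ge 0$ put $\omega_f(\delta)=\sup\{d(f(x),f(x')):x,x'\in X,\ d(x,x')\le\delta\}\in[0,\infty]$. The map $f$ is *bi-uniform* if for every $\varepsilon>0$ there is $\delta>0$ with $\omega_f(\delta)\le\varepsilon$, and for every $\delta<\infty$ there is $\varepsilon<\infty$ with $\omega_f(\delta)\le\varepsilon$. Two metric spaces are *bi-uniformly equivalent* if there is a bijection $f$ between them such that $f$ and $f^{-1}$ are bi-uniform. A metric space $X$ is *isometrically homogeneous* if for all $x,y\in X$ there is a bijective isometry $f:X\to X$ with $f(x)=y$; it is *proper* if it is unbounded and all its closed balls are compact. For $s>0$ the *$s$-connected component* $C_s(x)$ of $x\in X$ is the set of all $y\in X$ for which there is a finite chain $y=z_0,z_1,\dots,z_n=x$ in $X$ with $d(z_{i-1},z_i)\le s$ for all $i$. The space $X$ has *bi-uniform dimension zero* if for every $\varepsilon>0$ there is $\delta>0$ with $\sup_{x\in X}\operatorname{diam}C_\delta(x)\le\varepsilon$, and for every $\delta<\infty$ there is $\varepsilon<\infty$ with $\sup_{x\in X}\operatorname{diam}C_\delta(x)\le\varepsilon$.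 The *Cantor bi-cube* is $$2^{<\mathbb Z}=\{(x_i)_{i\in\mathbb Z}\in\{0,1\}^{\mathbb Z}:\exists n\in\mathbb N\ \forall i>n\ (x_i=0)\},\qquad d((x_i),(y_i))=\max_{i\in\mathbb Z}2^i|x_i-y_i|.$$ **Corollary t6.** Let $X$ be a proper isometrically homogeneous metric space of bi-uniform dimension zero. 1. If $X$ is uncountable, then $X$ is bi-uniformly equivalent to the Cantor bi-cube $2^{<\mathbb Z}$. 2. If $X$ is countable, define for every prime $p$ $$f_X(p)=\sup\{n\in\{0,1,2,\dots\}:p^n\text{ divides }|C_s(x)|\text{ for some }x\in X\text{ and }s>0\}\in\{0,1,2,\dots\}\cup\{\infty\}$$ (all the sets $C_s(x)$ are finite in this case), and let $\mathbb Z_{f_X}=\bigoplus_p(\mathbb Z/p\mathbb Z)^{f_X(p)}$, where $p$ runs over the primes and $(\mathbb Z/p\mathbb Z)^{\infty}$ denotes the direct sum of countably infinitely many copies of $\mathbb Z/p\mathbb Z$. Then the group $\mathbb Z_{f_X}$ admits a proper left-invariant metric, and $X$ is bi-uniformly equivalent to $\mathbb Z_{f_X}$ endowed with any such metric. -/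

import Mathlib

open scoped ENNReal DirectSum

noncomputable section

namespace BiUniform

/-- The oscillation `ω_f(δ) = sup {dist (f x) (f x') : dist x x' ≤ δ}`, a value in `[0,∞]`. -/
def oscillation {X Y : Type*} [MetricSpace X] [MetricSpace Y] (f : X → Y) (δ : ℝ) : ℝ≥0∞ :=
  ⨆ (x : X) (x' : X) (_ : dist x x' ≤ δ), edist (f x) (f x')

/-- Uniform continuity, expressed by the oscillation. -/
def IsMicroUniform {X Y : Type*} [MetricSpace X] [MetricSpace Y] (f : X → Y) : Prop :=
  ∀ ε : ℝ, 0 < ε → ∃ δ : ℝ, 0 < δ ∧ oscillation f δ ≤ ENNReal.ofReal ε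

/-- For every finite `δ` the oscillation `ω_f(δ)` is bounded by a finite `ε`. -/
def IsMacroUniform {X Y : Type*} [MetricSpace X] [MetricSpace Y] (f : X → Y) : Prop :=
  ∀ δ : ℝ, 0 ≤ δ → ∃ ε : ℝ, 0 ≤ ε ∧ oscillation f δ ≤ ENNReal.ofReal ε

def IsBiUniform {X Y : Type*} [MetricSpace X] [MetricSpace Y] (f : X → Y) : Prop :=
  IsMicroUniform f ∧ IsMacroUniform f

/-- There is a bijection which is bi-uniform together with its inverse. -/
def BiUniformlyEquivalent (X Y : Type*) [MetricSpace X] [MetricSpace Y] : Prop :=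
  ∃ f : X ≃ Y, IsBiUniform f ∧ IsBiUniform f.symm

/-- Any point can be carried to any other point by a bijective isometry. -/
def IsIsometricallyHomogeneous (X : Type*) [MetricSpace X] : Prop :=
  ∀ x y : X, ∃ f : X ≃ᵢ X, f x = y

/-- Proper metric spaces, which here are by definition unbounded: `X` is unbounded
and all its closed balls are compact. -/
def IsProperUnbounded (X : Type*) [MetricSpace X] : Prop :=
  ¬ Bornology.IsBounded (Set.univ : Set X) ∧
    ∀ (x : X) (r : ℝ), 0 ≤ r → IsCompact (Metric.closedBall x r)

/-- The `s`-connected component of `x`: all points that are linked with `x` by a finite chain of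
points with steps of length at most `s`. -/
def component {X : Type*} [MetricSpace X] (s : ℝ) (x : X) : Set X :=
  {y | Relation.ReflTransGen (fun a b : X => dist a b ≤ s) y x}

/-- The supremum of the diameters of all `s`-connected components. -/
def meshComponents (X : Type*) [MetricSpace X] (s : ℝ) : ℝ≥0∞ :=
  ⨆ x : X, Metric.ediam (component s x)

def MicroUniformDimZero (X : Type*) [MetricSpace X] : Prop :=
  ∀ ε : ℝ, 0 < ε → ∃ δ : ℝ, 0 < δ ∧ meshComponents X δ ≤ ENNReal.ofReal ε

/-- Asymptotic dimension zero. -/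
def MacroUniformDimZero (X : Type*) [MetricSpace X] : Prop :=
  ∀ δ : ℝ, 0 < δ → ∃ ε : ℝ, 0 < ε ∧ meshComponents X δ ≤ ENNReal.ofReal ε

def BiUniformDimZero (X : Type*) [MetricSpace X] : Prop :=
  MicroUniformDimZero X ∧ MacroUniformDimZero X

/-- The Cantor bi-cube: two-sided 0-1 sequences that vanish at all large indices. -/
def CantorBiCube : Type :=
  {x : ℤ → Fin 2 // ∃ n : ℕ, ∀ i : ℤ, (n : ℤ) < i → x i = 0}

namespace CantorBiCube

/-- The term `2 ^ i * |x i - y i|`. -/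
def term (x y : CantorBiCube) (i : ℤ) : ℝ :=
  (2 : ℝ) ^ i * |((x.1 i : ℕ) : ℝ) - ((y.1 i : ℕ) : ℝ)|

theorem term_nonneg (x y : CantorBiCube) (i : ℤ) : 0 ≤ term x y i := by
  unfold term
  positivity

theorem bddAbove_term (x y : CantorBiCube) : BddAbove (Set.range (term x y)) := by
  obtain ⟨n, hn⟩ := x.2
  obtain ⟨m, hm⟩ := y.2
  refine ⟨(2 : ℝ) ^ (max n m : ℤ), ?_⟩
  rintro _ ⟨i, rfl⟩
  unfold term
  by_cases hi : i ≤ max (n : ℤ) m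
  · have h1 : |((x.1 i : ℕ) : ℝ) - ((y.1 i : ℕ) : ℝ)| ≤ 1 := by
      generalize x.1 i = a
      generalize y.1 i = b
      fin_cases a <;> fin_cases b <;> simp
    have h2 : (2 : ℝ) ^ i ≤ (2 : ℝ) ^ (max n m : ℤ) :=
      zpow_le_zpow_right₀ (by norm_num) hi
    calc _ ≤ (2 : ℝ) ^ i * 1 := by gcongr
      _ ≤ _ := by simpa using h2
  · rw [hn i (by omega), hm i (by omega)]
    simp only [sub_self, abs_zero, mul_zero]
    positivity

/-- The ultrametric `d(x, y) = max_i 2 ^ i * |x i - y i|`. The family of the terms is bounded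
(and the supremum is attained), since both sequences vanish at all large indices. -/
instance : MetricSpace CantorBiCube where
  dist x y := ⨆ i : ℤ, term x y i
  dist_self x := by simp [term]
  dist_comm x y := by simp only [term, abs_sub_comm]
  dist_triangle x y z := by
    refine ciSup_le fun i => ?_
    refine le_trans ?_ (add_le_add (le_ciSup (bddAbove_term x y) i)
      (le_ciSup (bddAbove_term y z) i))
    unfold term
    rw [← mul_add]
    gcongr
    exact abs_sub_le _ _ _
  eq_of_dist_eq_zero := by
    intro x y h
    refine Subtype.ext (funext fun i => ?_)
    have h1 : term x y i ≤ 0 := h ▸ le_ciSup (bddAbove_term x y) i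
    have h2 : term x y i = 0 := le_antisymm h1 (term_nonneg x y i)
    unfold term at h2
    have h3 : (2 : ℝ) ^ i ≠ 0 := by positivity
    have h4 := (mul_eq_zero.mp h2).resolve_left h3
    rw [abs_eq_zero, sub_eq_zero] at h4
    exact Fin.ext (by exact_mod_cast h4)

end CantorBiCube

/-- The function `f_X`: the supremum in `{0,1,2,…,∞}` of all `n` such that `p ^ n` divides the
cardinality of some `s`-connected component, `s > 0`. It is meant for spaces in which all these
components are finite (which is so for countable proper isometrically homogeneous spaces of
asymptotic dimension zero). -/
def primeExponent (X : Type*) [MetricSpace X] (p : Nat.Primes) : ℕ∞ :=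
  sSup {m : ℕ∞ | ∃ n : ℕ, m = n ∧ ∃ (x : X) (s : ℝ), 0 < s ∧ (p : ℕ) ^ n ∣ (component s x).ncard}

/-- The group `⊕_p (ℤ/p)^{f(p)}`, where `(ℤ/p)^{f(p)}` is the direct sum of `f(p)` copies of `ℤ/p`
(of countably many copies if `f(p) = ∞`). -/
abbrev ZGroup (f : Nat.Primes → ℕ∞) : Type :=
  ⨁ p : Nat.Primes, ({k : ℕ // (k : ℕ∞) < f p} →₀ ZMod (p : ℕ))

/-- A metric on an additive group is left-invariant if all left translations are isometries. -/
def IsLeftInvariant {G : Type*} [AddGroup G] (d : MetricSpace G) : Prop :=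
  ∀ g x y : G, d.dist (g + x) (g + y) = d.dist x y

/-- The metric is left-invariant, unbounded, and its closed balls are compact in
the topology of the metric. -/
def IsProperLeftInvariant {G : Type*} [AddGroup G] (d : MetricSpace G) : Prop :=
  IsProperUnbounded G ∧ IsLeftInvariant d

end BiUniform

end

namespace BiUniform

/-! ### Recursion and induction towards `-∞` -/

/-! Fix scales `s k`, `k ∈ ℤ`, at least doubling at each step. Homogeneity makes every `s
(k+1)`-component split into the same number `r k` of `s k`-components, and compactness makes `r k`
finite. Numbering the pieces, with digit 0 along a base point, codes points by digit sequences `c k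
< r k` vanishing for large `k`. Dimension zero at small and large scales says exactly that closeness
of points is agreement of digits from some place on (`exists_isCoding_chainIndex`), and completeness
of the balls realizes every admissible sequence. Two spaces coded with the same digit numbers are
therefore bi-uniformly equivalent.

The remaining task is to change the digit numbers from `r` to a prescribed `n`. A new cluster at
level `k` is a union of `j` old components of level `k` inside one old component of level `k+1`. The
`j` members of a cluster of level `k+1` together have `j * r k` pieces, which are regrouped into
exactly `n k` clusters of sizes between `a k` and `b k`. Since old and new clusters are nested with
a shift of at most one level, closeness is preserved (`IsCoding.exists_recoding`).

In the uncountable case all components are infinite, so each `r k` can be made as large as needed by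
the choice of scales. This leaves enough room to keep the sizes in suitable intervals while every `n
k` is a power of 2, the digit number of a block of the Cantor bi-cube.

In the countable case the space is uniformly discrete and components are finite, of cardinalities
that divide each other along the scales. If these cardinalities in two spaces are cofinal in each
other for divisibility, interleaving them allows exact regrouping (`biUniformlyEquivalent_of_dvd`).
By the definition of `primeExponent`, this applies to `X` and `ZGroup (primeExponent X)`, prime by
prime. -/

theorem descending_induction {P : ℤ → Prop} {k : ℤ} (K : ℤ) (hK : ∀ i ≥ K, P i)
    (step : ∀ i ≥ k, P (i + 1) → P i) : ∀ i ≥ k, P i := by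
  have key : ∀ n : ℕ, ∀ i ≥ k, K ≤ i + n → P i := by
    intro n
    induction n with
    | zero => intro i _ h; exact hK i (by simpa using h)
    | succ n ih =>
      intro i hi h
      exact step i hi (ih (i + 1) (by omega) (by push_cast at h; omega))
  intro i hi
  exact key (K - i).toNat i hi (by omega)

/-- The sequence `b` already solves the recursion above `K`, so only the steps downwards from `K`
have to be performed. -/
theorem exists_descending {A : Type*} (step : ℤ → A → A) (b : ℤ → A) (K : ℤ)
    (hb : ∀ k ≥ K, step k (b (k + 1)) = b k) :
    ∃ a : ℤ → A, (∀ k, a k = step k (a (k + 1))) ∧ ∀ k ≥ K, a k = b k := by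
  let f : ℕ → A := fun n => Nat.rec (b K) (fun n x => step (K - n - 1) x) n
  have hf : ∀ n : ℕ, f (n + 1) = step (K - n - 1) (f n) := fun n => rfl
  refine ⟨fun k => if K ≤ k then b k else f (K - k).toNat, fun k => ?_, fun k hk => if_pos hk⟩
  by_cases h : K ≤ k
  · have h' : K ≤ k + 1 := by omega
    simp only [h, h', if_true]
    exact (hb k h).symm
  · obtain ⟨n, hn⟩ : ∃ n : ℕ, k = K - n - 1 := ⟨(K - k - 1).toNat, by omega⟩
    have e1 : (K - k).toNat = n + 1 := by omega
    have e2 : k + 1 = K - n := by omega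
    simp only [h, if_false, e1, hf, ← hn, e2]
    by_cases h0 : K ≤ K - n
    · have : n = 0 := by omega
      subst this
      simp [f]
    · simp only [h0, if_false]
      congr 2
      omega

/-- Bi-infinite sequences of states, from a state that can be continued in both directions. -/
theorem exists_biinfinite_chain {σ : Type*} (S : σ → σ → Prop) (U D : σ → Prop)
    (up : ∀ x, U x → ∃ y, U y ∧ S x y) (down : ∀ x, D x → ∃ y, D y ∧ S y x)
    (x₀ : σ) (hU : U x₀) (hD : D x₀) : ∃ f : ℤ → σ, ∀ k, S (f k) (f (k + 1)) := by
  choose! u hu using up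
  choose! d hd using down
  let F : ℕ → σ := fun n => u^[n] x₀
  let B : ℕ → σ := fun n => d^[n] x₀
  have hF : ∀ n, U (F n) := by
    intro n
    induction n with
    | zero => exact hU
    | succ n ih => simp only [F, Function.iterate_succ_apply']; exact (hu _ ih).1
  have hB : ∀ n, D (B n) := by
    intro n
    induction n with
    | zero => exact hD
    | succ n ih => simp only [B, Function.iterate_succ_apply']; exact (hd _ ih).1
  refine ⟨fun k => if 0 ≤ k then F k.toNat else B (-k).toNat, fun k => ?_⟩
  by_cases h : 0 ≤ k
  · have h1 : 0 ≤ k + 1 := by omega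
    have h2 : (k + 1).toNat = k.toNat + 1 := by omega
    simp only [h, h1, if_true, h2]
    simp only [F, Function.iterate_succ_apply']
    exact (hu _ (hF _)).2
  · obtain ⟨n, hn⟩ : ∃ n : ℕ, k = -(n + 1 : ℤ) := ⟨(-k - 1).toNat, by omega⟩
    have h2 : (-k).toNat = n + 1 := by omega
    have h3 : (if 0 ≤ k + 1 then F (k + 1).toNat else B (-(k + 1)).toNat) = B n := by
      split_ifs with h4
      · have : n = 0 := by omega
        subst this
        have : (k + 1).toNat = 0 := by omega
        rw [this]
        rfl
      · congr 1
        omega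
    simp only [h, if_false, h2, h3]
    simp only [B, Function.iterate_succ_apply']
    exact (hd _ (hB _)).2

/-! ### Codings by sequences -/

/-- A coding of a metric space by the two-sided sequences of digits, `n k` digits at place `k`,
that vanish at all large places, in which closeness amounts to agreement from some place on. -/
structure IsCoding {X : Type*} [MetricSpace X] (n : ℤ → ℕ) (c : X → ℤ → ℕ) : Prop where
  injective : Function.Injective c
  lt : ∀ x k, c x k < n k
  eventually_zero : ∀ x, ∃ K, ∀ k ≥ K, c x k = 0
  surj : ∀ l : ℤ → ℕ, (∀ k, l k < n k) → (∃ K, ∀ k ≥ K, l k = 0) → ∃ x, c x = l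
  micro_dist : ∀ ε : ℝ, 0 < ε → ∃ k, ∀ x y, (∀ i ≥ k, c x i = c y i) → dist x y ≤ ε
  micro_agree : ∀ k, ∃ δ : ℝ, 0 < δ ∧ ∀ x y, dist x y ≤ δ → ∀ i ≥ k, c x i = c y i
  macro_agree : ∀ δ : ℝ, ∃ k, ∀ x y, dist x y ≤ δ → ∀ i ≥ k, c x i = c y i
  macro_dist : ∀ k, ∃ D : ℝ, ∀ x y, (∀ i ≥ k, c x i = c y i) → dist x y ≤ D

theorem oscillation_le {X Y : Type*} [MetricSpace X] [MetricSpace Y] {f : X → Y} {δ ε : ℝ}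
    (h : ∀ x x', dist x x' ≤ δ → dist (f x) (f x') ≤ ε) :
    oscillation f δ ≤ ENNReal.ofReal ε := by
  refine iSup_le fun x => iSup_le fun x' => iSup_le fun hx => ?_
  rw [edist_dist]
  exact ENNReal.ofReal_le_ofReal (h x x' hx)

theorem IsCoding.isBiUniform {X Y : Type*} [MetricSpace X] [MetricSpace Y] {n : ℤ → ℕ}
    {c : X → ℤ → ℕ} {d : Y → ℤ → ℕ} (hc : IsCoding n c) (hd : IsCoding n d) {f : X → Y}
    (hf : ∀ x, d (f x) = c x) : IsBiUniform f := by
  constructor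
  · intro ε hε
    obtain ⟨k, hk⟩ := hd.micro_dist ε hε
    obtain ⟨δ, hδ, h⟩ := hc.micro_agree k
    refine ⟨δ, hδ, oscillation_le fun x x' hx => hk _ _ ?_⟩
    simpa only [hf] using h x x' hx
  · intro δ _
    obtain ⟨k, hk⟩ := hc.macro_agree δ
    obtain ⟨D, hD⟩ := hd.macro_dist k
    refine ⟨max D 0, le_max_right _ _, oscillation_le fun x x' hx => ?_⟩
    refine (hD _ _ ?_).trans (le_max_left _ _)
    simpa only [hf] using hk x x' hx

theorem IsCoding.biUniformlyEquivalent {X Y : Type*} [MetricSpace X] [MetricSpace Y] {n : ℤ → ℕ}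
    {c : X → ℤ → ℕ} {d : Y → ℤ → ℕ} (hc : IsCoding n c) (hd : IsCoding n d) :
    BiUniformlyEquivalent X Y := by
  have h1 : ∀ x, ∃ y, d y = c x := fun x => hd.surj _ (hc.lt x) (hc.eventually_zero x)
  have h2 : ∀ y, ∃ x, c x = d y := fun y => hc.surj _ (hd.lt y) (hd.eventually_zero y)
  choose f hf using h1
  choose g hg using h2
  let F : X ≃ Y :=
    { toFun := f
      invFun := g
      left_inv := fun x => hc.injective (by rw [hg, hf])
      right_inv := fun y => hd.injective (by rw [hf, hg]) }
  exact ⟨F, hc.isBiUniform hd hf, hd.isBiUniform hc hg⟩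

/-! ### Splittings -/

/-- The data of a correspondence between the pairs (group, item) and the pairs (part, position). -/
structure SplitMap where
  /-- the size of a part -/
  size : ℕ → ℕ
  /-- the group to which a part belongs -/
  group : ℕ → ℕ
  /-- the part to which an item of a group belongs -/
  part : ℕ → ℕ → ℕ
  /-- the position of an item of a group in its part -/
  pos : ℕ → ℕ → ℕ
  /-- the item at a position of a part -/
  item : ℕ → ℕ → ℕ

/-- `S` splits `j` groups of `r` items each into `n` parts, each of them within one group and of
a size between `a` and `b`, the first part having `w` elements. -/
structure IsSplitting (S : SplitMap) (j r n a b w : ℕ) : Prop where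
  le_size : ∀ y < n, a ≤ S.size y
  size_le : ∀ y < n, S.size y ≤ b
  part_lt : ∀ t < j, ∀ x < r, S.part t x < n
  pos_lt : ∀ t < j, ∀ x < r, S.pos t x < S.size (S.part t x)
  group_part : ∀ t < j, ∀ x < r, S.group (S.part t x) = t
  item_pos : ∀ t < j, ∀ x < r, S.item (S.part t x) (S.pos t x) = x
  group_lt : ∀ y < n, S.group y < j
  item_lt : ∀ y < n, ∀ t < S.size y, S.item y t < r
  part_item : ∀ y < n, ∀ t < S.size y, S.part (S.group y) (S.item y t) = y
  pos_item : ∀ y < n, ∀ t < S.size y, S.pos (S.group y) (S.item y t) = t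
  part_zero : S.part 0 0 = 0
  pos_zero : S.pos 0 0 = 0
  size_zero : S.size 0 = w

theorem exists_fin_sum_eq (N a b r : ℕ) (h1 : N * a ≤ r) (h2 : r ≤ N * b) :
    ∃ s : Fin N → ℕ, (∀ i, a ≤ s i ∧ s i ≤ b) ∧ ∑ i, s i = r := by
  induction N generalizing r with
  | zero =>
    refine ⟨fun _ => 0, fun i => i.elim0, ?_⟩
    simp at h1 h2 ⊢
    omega
  | succ N ih =>
    have hab' : a ≤ b := by
      by_contra! h
      nlinarith [Nat.zero_le N]
    have hN : N * a ≤ N * b := Nat.mul_le_mul_left _ hab'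
    simp only [Nat.succ_mul] at h1 h2
    -- The first summand is the larger of `a` and `r - N * b`, the least value in range that leaves
    -- at most `N * b` for the others.
    obtain ⟨x, hx1, hx2, hx3, hx4⟩ : ∃ x, a ≤ x ∧ x ≤ b ∧ N * a + x ≤ r ∧ r ≤ N * b + x := by
      by_cases h : N * b + a ≤ r
      · exact ⟨r - N * b, by omega, by omega, by omega, by omega⟩
      · exact ⟨a, le_rfl, hab', by omega, by omega⟩
    obtain ⟨s, hs, hs'⟩ := ih (r - x) (by omega) (by omega)
    refine ⟨Fin.cons x s, fun i => ?_, ?_⟩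
    · refine Fin.cases ?_ (fun i => ?_) i
      · exact ⟨hx1, hx2⟩
      · simpa using hs i
    · rw [Fin.sum_univ_succ]
      simp only [Fin.cons_zero, Fin.cons_succ, hs']
      omega

theorem exists_equiv_of_card_eq {A B : Type*} [Fintype A] [Fintype B]
    (h : Fintype.card A = Fintype.card B) (x : A) (y : B) : ∃ e : A ≃ B, e x = y := by
  classical
  let e := Fintype.equivOfCardEq h
  exact ⟨e.trans (Equiv.swap (e x) y), by simp⟩

/-- Each group receives between `p` and `q` parts, which is possible since `j * p ≤ n ≤ j * q`.
Within a group the first part takes `w` items, and the bounds on `r` let the other parts share `r -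
w` with sizes in `[a, b]`, whatever their number is. -/
theorem exists_isSplitting {j r n a b w p q : ℕ} (hj : 1 ≤ j) (ha : 1 ≤ a) (haw : a ≤ w)
    (hwb : w ≤ b) (hp : 1 ≤ p) (hn : j * p ≤ n) (hn' : n ≤ j * q)
    (hr : w + (q - 1) * a ≤ r) (hr' : r ≤ w + (p - 1) * b) :
    ∃ S, IsSplitting S j r n a b w := by
  classical
  obtain ⟨N, hN, hNsum⟩ := exists_fin_sum_eq j p q n hn hn'
  have hs : ∀ t : Fin j, ∃ s : Fin (N t - 1 + 1) → ℕ, (∀ i, a ≤ s i ∧ s i ≤ b) ∧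
      ∑ i, s i = r ∧ s 0 = w := by
    intro t
    have h1 : (N t - 1) * a ≤ (q - 1) * a :=
      Nat.mul_le_mul_right _ (Nat.sub_le_sub_right (hN t).2 1)
    have h2 : (p - 1) * b ≤ (N t - 1) * b :=
      Nat.mul_le_mul_right _ (Nat.sub_le_sub_right (hN t).1 1)
    obtain ⟨s, hs, hs'⟩ := exists_fin_sum_eq (N t - 1) a b (r - w) (by omega) (by omega)
    refine ⟨Fin.cons w s, fun i => ?_, ?_, rfl⟩
    · refine Fin.cases ?_ (fun i => ?_) i
      · exact ⟨haw, hwb⟩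
      · simpa using hs i
    · rw [Fin.sum_univ_succ]
      simp only [Fin.cons_zero, Fin.cons_succ, hs']
      omega
  choose s hs hsum hs0 using hs
  have hrpos : 0 < r := by omega
  have hnpos : 0 < n := by nlinarith
  have cardP : Fintype.card (Fin n) = Fintype.card (Σ t : Fin j, Fin (N t - 1 + 1)) := by
    rw [Fintype.card_sigma]
    simp only [Fintype.card_fin]
    rw [← hNsum]
    refine Finset.sum_congr rfl fun t _ => ?_
    have := (hN t).1
    omega
  -- The bijections are normalized at 0, so that the zero sequence is later recoded as the zero
  -- sequence.
  obtain ⟨e, he⟩ := exists_equiv_of_card_eq cardP ⟨0, hnpos⟩ ⟨⟨0, hj⟩, 0⟩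
  have cardI : ∀ t : Fin j, Fintype.card (Fin r) =
      Fintype.card (Σ i : Fin (N t - 1 + 1), Fin (s t i)) := by
    intro t
    rw [Fintype.card_sigma]
    simp [hsum]
  have hs0' : ∀ t, 0 < s t 0 := fun t => by rw [hs0]; omega
  have hg := fun t => exists_equiv_of_card_eq (cardI t) ⟨0, hrpos⟩ ⟨0, ⟨0, hs0' t⟩⟩
  choose g hg using hg
  let sz : Fin n → ℕ := fun y => s (e y).1 (e y).2
  let S : SplitMap :=
    { size := fun y => if h : y < n then sz ⟨y, h⟩ else 0
      group := fun y => if h : y < n then (e ⟨y, h⟩).1 else 0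
      part := fun t x => if h : t < j ∧ x < r then
        e.symm ⟨⟨t, h.1⟩, (g ⟨t, h.1⟩ ⟨x, h.2⟩).1⟩ else 0
      pos := fun t x => if h : t < j ∧ x < r then (g ⟨t, h.1⟩ ⟨x, h.2⟩).2 else 0
      item := fun y t => if h : ∃ h : y < n, t < sz ⟨y, h⟩ then
        (g (e ⟨y, h.1⟩).1).symm ⟨(e ⟨y, h.1⟩).2, ⟨t, h.2⟩⟩ else 0 }
  have hsize : ∀ y : Fin n, S.size y = sz y := fun y => by simp [S]
  have hgroup : ∀ y : Fin n, S.group y = (e y).1 := fun y => by simp [S]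
  have hpart : ∀ (t : Fin j) (x : Fin r), S.part t x = e.symm ⟨t, (g t x).1⟩ :=
    fun t x => by simp [S]
  have hpos : ∀ (t : Fin j) (x : Fin r), S.pos t x = (g t x).2 := fun t x => by simp [S]
  have hitem : ∀ (y : Fin n) (t : Fin (sz y)),
      S.item y t = (g (e y).1).symm ⟨(e y).2, t⟩ := fun y t => by simp [S]
  have hsize' : ∀ (t : Fin j) (i : Fin (N t - 1 + 1)), S.size (e.symm ⟨t, i⟩ : Fin n) = s t i := by
    intro t i
    rw [hsize]
    change s (e _).1 (e _).2 = _
    rw [Equiv.apply_symm_apply]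
  have hitem' : ∀ (t : Fin j) (i : Fin (N t - 1 + 1)) (m : Fin (s t i)),
      S.item (e.symm ⟨t, i⟩ : Fin n) m = (g t).symm ⟨i, m⟩ := by
    intro t i m
    have := hitem (e.symm ⟨t, i⟩)
    simp only [sz] at this
    rw [Equiv.apply_symm_apply] at this
    exact this m
  refine ⟨S, ?_, ?_, ?_, ?_, ?_, ?_, ?_, ?_, ?_, ?_, ?_, ?_, ?_⟩
  · intro y hy
    rw [show y = ((⟨y, hy⟩ : Fin n) : ℕ) from rfl, hsize]
    exact (hs _ _).1
  · intro y hy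
    rw [show y = ((⟨y, hy⟩ : Fin n) : ℕ) from rfl, hsize]
    exact (hs _ _).2
  · intro t ht x hx
    have := hpart ⟨t, ht⟩ ⟨x, hx⟩
    simp only at this
    rw [this]
    exact Fin.is_lt _
  · intro t ht x hx
    have h1 := hpart ⟨t, ht⟩ ⟨x, hx⟩
    have h2 := hpos ⟨t, ht⟩ ⟨x, hx⟩
    simp only at h1 h2
    rw [h1, h2, hsize']
    exact Fin.is_lt _
  · intro t ht x hx
    have h1 := hpart ⟨t, ht⟩ ⟨x, hx⟩
    simp only at h1
    rw [h1, hgroup, Equiv.apply_symm_apply]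
  · intro t ht x hx
    have h1 := hpart ⟨t, ht⟩ ⟨x, hx⟩
    have h2 := hpos ⟨t, ht⟩ ⟨x, hx⟩
    simp only at h1 h2
    rw [h1, h2, hitem']
    simp
  · intro y hy
    have := hgroup ⟨y, hy⟩
    simp only at this
    rw [this]
    exact Fin.is_lt _
  · intro y hy t ht
    have h0 := hsize ⟨y, hy⟩
    simp only at h0
    have h1 := hitem ⟨y, hy⟩ ⟨t, h0 ▸ ht⟩
    simp only at h1
    rw [h1]
    exact Fin.is_lt _
  · intro y hy t ht
    have h0 := hsize ⟨y, hy⟩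
    simp only at h0
    have h1 := hitem ⟨y, hy⟩ ⟨t, h0 ▸ ht⟩
    have h2 := hgroup ⟨y, hy⟩
    simp only at h1 h2
    rw [h1, h2, hpart]
    simp
  · intro y hy t ht
    have h0 := hsize ⟨y, hy⟩
    simp only at h0
    have h1 := hitem ⟨y, hy⟩ ⟨t, h0 ▸ ht⟩
    have h2 := hgroup ⟨y, hy⟩
    simp only at h1 h2
    rw [h1, h2, hpos, Equiv.apply_symm_apply]
  · have h1 := hpart ⟨0, hj⟩ ⟨0, hrpos⟩
    change S.part 0 0 = _ at h1
    rw [h1, hg]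
    rw [← he, Equiv.symm_apply_apply]
  · have h1 := hpos ⟨0, hj⟩ ⟨0, hrpos⟩
    change S.pos 0 0 = _ at h1
    rw [h1, hg]
  · have h1 := hsize ⟨0, hnpos⟩
    change S.size 0 = s (e _).1 (e _).2 at h1
    rw [h1, he]
    exact hs0 _

/-! ### Recoding -/

/-- The sequences `u` and `y` are translated into each other by the splittings `S`, with the
states `j` (the size of the current part) and `t` (the position in the current part). -/
structure IsRecoding (S : ℤ → ℕ → SplitMap) (r n w : ℤ → ℕ) (u y j t : ℤ → ℕ) : Prop where
  item_lt : ∀ k, u k < r k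
  part_lt : ∀ k, y k < n k
  part_eq : ∀ k, y k = (S k (j (k + 1))).part (t (k + 1)) (u k)
  pos_eq : ∀ k, t k = (S k (j (k + 1))).pos (t (k + 1)) (u k)
  size_eq : ∀ k, j k = (S k (j (k + 1))).size (y k)
  group_eq : ∀ k, t (k + 1) = (S k (j (k + 1))).group (y k)
  item_eq : ∀ k, u k = (S k (j (k + 1))).item (y k) (t k)
  eventually_base : ∃ K, ∀ k ≥ K, u k = 0 ∧ y k = 0 ∧ j k = w k ∧ t k = 0

section Recoding

variable {S : ℤ → ℕ → SplitMap} {r n a b w : ℤ → ℕ}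

/-- Both recodings are in the same base state at large places, and equal digits carry equal states
down. -/
theorem IsRecoding.agree_parts {u y j t u' y' j' t' : ℤ → ℕ} (h : IsRecoding S r n w u y j t)
    (h' : IsRecoding S r n w u' y' j' t') {k : ℤ} (hu : ∀ i ≥ k, u i = u' i) :
    ∀ i ≥ k, y i = y' i := by
  obtain ⟨K, hK⟩ := h.eventually_base
  obtain ⟨K', hK'⟩ := h'.eventually_base
  have key : ∀ i ≥ k, (j i = j' i ∧ t i = t' i) ∧ y i = y' i := by
    refine descending_induction (max K K') (fun i hi => ?_) (fun i hi ih => ?_)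
    · obtain ⟨-, h2, h3, h4⟩ := hK i (le_trans (le_max_left _ _) hi)
      obtain ⟨-, h2', h3', h4'⟩ := hK' i (le_trans (le_max_right _ _) hi)
      exact ⟨⟨by rw [h3, h3'], by rw [h4, h4']⟩, by rw [h2, h2']⟩
    · have hy : y i = y' i := by rw [h.part_eq, h'.part_eq, ih.1.1, ih.1.2, hu i hi]
      exact ⟨⟨by rw [h.size_eq, h'.size_eq, ih.1.1, hy],
        by rw [h.pos_eq, h'.pos_eq, ih.1.1, ih.1.2, hu i hi]⟩, hy⟩
  exact fun i hi => (key i hi).2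

/-- One place is lost because the position `t i`, needed to find the item `u i`, is the group
containing the part `y (i - 1)`. -/
theorem IsRecoding.agree_items {u y j t u' y' j' t' : ℤ → ℕ} (h : IsRecoding S r n w u y j t)
    (h' : IsRecoding S r n w u' y' j' t') {k : ℤ} (hy : ∀ i ≥ k, y i = y' i) :
    ∀ i ≥ k + 1, u i = u' i := by
  obtain ⟨K, hK⟩ := h.eventually_base
  obtain ⟨K', hK'⟩ := h'.eventually_base
  have key : ∀ i ≥ k, j i = j' i := by
    refine descending_induction (max K K') (fun i hi => ?_) (fun i hi ih => ?_)
    · rw [(hK i (le_trans (le_max_left _ _) hi)).2.2.1,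
        (hK' i (le_trans (le_max_right _ _) hi)).2.2.1]
    · rw [h.size_eq, h'.size_eq, ih, hy i hi]
  intro i hi
  obtain ⟨m, rfl⟩ : ∃ m, i = m + 1 := ⟨i - 1, by omega⟩
  rw [h.item_eq, h'.item_eq, h.group_eq, h'.group_eq, key (m + 1) (by omega),
    key (m + 1 + 1) (by omega), hy m (by omega), hy (m + 1) (by omega)]

variable (haw : ∀ k, a k ≤ w k) (hwb : ∀ k, w k ≤ b k) (hw : ∀ k, 1 ≤ w k) (hr : ∀ k, 0 < r k)
  (hS : ∀ k j, a (k + 1) ≤ j → j ≤ b (k + 1) → IsSplitting (S k j) j (r k) (n k) (a k) (b k) (w k))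

include haw hwb hw hS

/-- The pair of size and position is computed downwards from the base state. The invariant, size in
`[a k, b k]` and position below the size, keeps the splittings applicable. -/
theorem exists_isRecoding_of_items {u : ℤ → ℕ} (hu : ∀ k, u k < r k)
    (hu0 : ∃ K, ∀ k ≥ K, u k = 0) : ∃ y j t, IsRecoding S r n w u y j t := by
  obtain ⟨K, hK⟩ := hu0
  have hSw := fun k => hS k (w (k + 1)) (haw _) (hwb _)
  obtain ⟨s, hs, hsK⟩ := exists_descending
    (fun k (s : ℕ × ℕ) => ((S k s.1).size ((S k s.1).part s.2 (u k)), (S k s.1).pos s.2 (u k)))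
    (fun k => (w k, 0)) K (fun k hk => by
      simp only [hK k hk, (hSw k).part_zero, (hSw k).size_zero, (hSw k).pos_zero])
  have hj : ∀ k, (s k).1 = (S k (s (k + 1)).1).size ((S k (s (k + 1)).1).part (s (k + 1)).2 (u k)) :=
    fun k => congrArg Prod.fst (hs k)
  have ht : ∀ k, (s k).2 = (S k (s (k + 1)).1).pos (s (k + 1)).2 (u k) :=
    fun k => congrArg Prod.snd (hs k)
  have inv : ∀ k, a k ≤ (s k).1 ∧ (s k).1 ≤ b k ∧ (s k).2 < (s k).1 := by
    intro k
    refine descending_induction (k := k) (P := fun k => a k ≤ (s k).1 ∧ (s k).1 ≤ b k ∧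
      (s k).2 < (s k).1) K (fun i hi => ?_) (fun i _ ih => ?_) k le_rfl
    · rw [hsK i hi]
      exact ⟨haw i, hwb i, hw i⟩
    · have hSi := hS i _ ih.1 ih.2.1
      rw [hj i, ht i]
      have := hSi.part_lt _ ih.2.2 _ (hu i)
      exact ⟨hSi.le_size _ this, hSi.size_le _ this, hSi.pos_lt _ ih.2.2 _ (hu i)⟩
  refine ⟨fun k => (S k (s (k + 1)).1).part (s (k + 1)).2 (u k), fun k => (s k).1,
    fun k => (s k).2, hu, fun k => ?_, fun k => rfl, ht, hj, fun k => ?_, fun k => ?_, K, ?_⟩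
  · exact (hS k _ (inv _).1 (inv _).2.1).part_lt _ (inv _).2.2 _ (hu k)
  · exact ((hS k _ (inv _).1 (inv _).2.1).group_part _ (inv _).2.2 _ (hu k)).symm
  · simp only [ht k]
    exact ((hS k _ (inv _).1 (inv _).2.1).item_pos _ (inv _).2.2 _ (hu k)).symm
  · intro k hk
    have h1 := hsK (k + 1) (by omega)
    refine ⟨hK k hk, ?_, by rw [hsK k hk], by rw [hsK k hk]⟩
    simp only [h1, hK k hk, (hSw k).part_zero]

include hr

/-- Only the sizes need a recursion: the positions are then read off from the part one place lower.
-/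
theorem exists_isRecoding_of_parts {y : ℤ → ℕ} (hy : ∀ k, y k < n k)
    (hy0 : ∃ K, ∀ k ≥ K, y k = 0) : ∃ u j t, IsRecoding S r n w u y j t := by
  obtain ⟨K, hK⟩ := hy0
  have hSw := fun k => hS k (w (k + 1)) (haw _) (hwb _)
  obtain ⟨j, hj, hjK⟩ := exists_descending (fun k j => (S k j).size (y k)) w K
    (fun k hk => by rw [hK k hk, (hSw k).size_zero])
  have inv : ∀ k, a k ≤ j k ∧ j k ≤ b k := by
    intro k
    refine descending_induction (k := k) (P := fun k => a k ≤ j k ∧ j k ≤ b k)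
      K (fun i hi => ?_) (fun i _ ih => ?_) k le_rfl
    · rw [hjK i hi]
      exact ⟨haw i, hwb i⟩
    · have hSi := hS i _ ih.1 ih.2
      rw [hj]
      exact ⟨hSi.le_size _ (hy i), hSi.size_le _ (hy i)⟩
  have hSj := fun k => hS k _ (inv (k + 1)).1 (inv (k + 1)).2
  have group_zero : ∀ k, (S k (w (k + 1))).group 0 = 0 := by
    intro k
    have := (hSw k).group_part 0 (hw _) 0 (hr k)
    rwa [(hSw k).part_zero] at this
  have item_zero : ∀ k, (S k (w (k + 1))).item 0 0 = 0 := by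
    intro k
    have := (hSw k).item_pos 0 (hw _) 0 (hr k)
    rwa [(hSw k).part_zero, (hSw k).pos_zero] at this
  let t : ℤ → ℕ := fun k => (S (k - 1) (j k)).group (y (k - 1))
  have ht : ∀ k, t (k + 1) = (S k (j (k + 1))).group (y k) := by
    intro k
    simp only [t, add_sub_cancel_right]
  have htj : ∀ k, t k < j k := by
    intro k
    obtain ⟨m, rfl⟩ : ∃ m, k = m + 1 := ⟨k - 1, by omega⟩
    rw [ht]
    exact (hSj m).group_lt _ (hy m)
  have htj' : ∀ k, t k < (S k (j (k + 1))).size (y k) := fun k => hj k ▸ htj k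
  refine ⟨fun k => (S k (j (k + 1))).item (y k) (t k), j, t, fun k => ?_, hy, fun k => ?_,
    fun k => ?_, hj, ht, fun k => rfl, K + 1, fun k hk => ?_⟩
  · exact (hSj k).item_lt _ (hy k) _ (htj' k)
  · rw [ht]
    exact ((hSj k).part_item _ (hy k) _ (htj' k)).symm
  · rw [ht]
    exact ((hSj k).pos_item _ (hy k) _ (htj' k)).symm
  · have h1 : t k = 0 := by
      obtain ⟨m, rfl⟩ : ∃ m, k = m + 1 := ⟨k - 1, by omega⟩
      rw [ht, hjK _ (by omega), hK m (by omega), group_zero]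
    refine ⟨?_, hK k (by omega), hjK k (by omega), h1⟩
    simp only [h1, hK k (by omega), hjK (k + 1) (by omega), item_zero]

theorem exists_isCoding_of_splittings {X : Type*} [MetricSpace X] {c : X → ℤ → ℕ}
    (hc : IsCoding r c) : ∃ d : X → ℤ → ℕ, IsCoding n d := by
  have hex := fun x => exists_isRecoding_of_items haw hwb hw hS (hc.lt x) (hc.eventually_zero x)
  choose d j t hd using hex
  have h1 : ∀ {x x' k}, (∀ i ≥ k, c x i = c x' i) → ∀ i ≥ k, d x i = d x' i :=
    fun h => (hd _).agree_parts (hd _) h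
  have h2 : ∀ {x x' k}, (∀ i ≥ k, d x i = d x' i) → ∀ i ≥ k + 1, c x i = c x' i :=
    fun h => (hd _).agree_items (hd _) h
  refine ⟨d, ⟨fun x x' hx => ?_, fun x => (hd x).part_lt, fun x => ?_, fun l hl hl0 => ?_,
    fun ε hε => ?_, fun k => ?_, fun δ => ?_, fun k => ?_⟩⟩
  · refine hc.injective (funext fun k => ?_)
    exact h2 (k := k - 1) (fun i _ => congrFun hx i) k (by omega)
  · obtain ⟨K, hK⟩ := (hd x).eventually_base
    exact ⟨K, fun k hk => (hK k hk).2.1⟩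
  · obtain ⟨u, j', t', h⟩ := exists_isRecoding_of_parts haw hwb hw hr hS hl hl0
    obtain ⟨K, hK⟩ := h.eventually_base
    obtain ⟨x, rfl⟩ := hc.surj u h.item_lt ⟨K, fun k hk => (hK k hk).1⟩
    exact ⟨x, funext fun k => (hd x).agree_parts h (k := k) (fun _ _ => rfl) k le_rfl⟩
  · obtain ⟨k, hk⟩ := hc.micro_dist ε hε
    refine ⟨k - 1, fun x x' h => hk _ _ fun i hi => h2 h i (by omega)⟩
  · obtain ⟨δ, hδ, h⟩ := hc.micro_agree k
    exact ⟨δ, hδ, fun x x' hx => h1 (h x x' hx)⟩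
  · obtain ⟨k, hk⟩ := hc.macro_agree δ
    exact ⟨k, fun x x' hx => h1 (hk x x' hx)⟩
  · obtain ⟨D, hD⟩ := hc.macro_dist (k + 1)
    exact ⟨D, fun x x' h => hD _ _ (h2 h)⟩

end Recoding

/-- Recoding with other numbers of digits: the digits at each place are regrouped, the size of the
parts at place `k` being between `a k` and `b k`. -/
theorem IsCoding.exists_recoding {X : Type*} [MetricSpace X] {r n a b w p q : ℤ → ℕ}
    {c : X → ℤ → ℕ} (hc : IsCoding r c) (ha : ∀ k, 1 ≤ a k) (haw : ∀ k, a k ≤ w k)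
    (hwb : ∀ k, w k ≤ b k) (hp : ∀ k, 1 ≤ p k) (hn : ∀ k, b (k + 1) * p k ≤ n k)
    (hn' : ∀ k, n k ≤ a (k + 1) * q k) (hr : ∀ k, w k + (q k - 1) * a k ≤ r k)
    (hr' : ∀ k, r k ≤ w k + (p k - 1) * b k) : ∃ d : X → ℤ → ℕ, IsCoding n d := by
  have hex : ∀ k j, ∃ S, a (k + 1) ≤ j → j ≤ b (k + 1) →
      IsSplitting S j (r k) (n k) (a k) (b k) (w k) := by
    intro k j
    by_cases hj : a (k + 1) ≤ j ∧ j ≤ b (k + 1)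
    · obtain ⟨S, hS⟩ := exists_isSplitting ((ha _).trans hj.1) (ha k) (haw k) (hwb k) (hp k)
        ((Nat.mul_le_mul_right _ hj.2).trans (hn k)) ((hn' k).trans (Nat.mul_le_mul_right _ hj.1))
        (hr k) (hr' k)
      exact ⟨S, fun _ _ => hS⟩
    -- A dummy value for sizes that never occur.
    · exact ⟨⟨id, id, fun _ => id, fun _ => id, fun _ => id⟩, fun h1 h2 => absurd ⟨h1, h2⟩ hj⟩
  choose S hS using hex
  refine exists_isCoding_of_splittings haw hwb (fun k => (ha k).trans (haw k)) (fun k => ?_) hS hc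
  have := hr k
  have := (ha k).trans (haw k)
  omega

/-! ### Chain components -/

section Chains

variable {X : Type*} [MetricSpace X]

/-- Being linked by a finite chain with steps of length at most `s`. -/
def chainSetoid (X : Type*) [MetricSpace X] (s : ℝ) : Setoid X where
  r x y := Relation.ReflTransGen (fun a b : X => dist a b ≤ s) x y
  iseqv :=
    { refl := fun _ => Relation.ReflTransGen.refl
      symm := fun {x y} h => by
        have : Std.Symm (fun a b : X => dist a b ≤ s) := ⟨fun a b h => by rwa [dist_comm]⟩
        exact symm_of _ h
      trans := fun h h' => h.trans h' }

theorem mem_component {s : ℝ} {x y : X} : y ∈ component s x ↔ chainSetoid X s y x := Iff.rfl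

theorem chainSetoid_of_dist_le {s : ℝ} {x y : X} (h : dist x y ≤ s) : chainSetoid X s x y :=
  Relation.ReflTransGen.single h

theorem chainSetoid_mono {s s' : ℝ} (h : s ≤ s') {x y : X} (hxy : chainSetoid X s x y) :
    chainSetoid X s' x y :=
  Relation.ReflTransGen.mono (fun _ _ hab => le_trans hab h) _ _ hxy

theorem chainSetoid_isometry {s : ℝ} (f : X ≃ᵢ X) {x y : X} (h : chainSetoid X s x y) :
    chainSetoid X s (f x) (f y) :=
  Relation.ReflTransGen.lift f 
    (fun a b hab => show dist (f a) (f b) ≤ s by rwa [f.isometry.dist_eq]) _ _ h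

theorem dist_le_of_chain {s ε : ℝ} (hε : 0 ≤ ε) (h : meshComponents X s ≤ ENNReal.ofReal ε)
    {x y : X} (hxy : chainSetoid X s x y) : dist x y ≤ ε := by
  have h1 : edist x y ≤ ENNReal.ofReal ε :=
    (Metric.edist_le_ediam_of_mem (s := component s y) hxy
      ((chainSetoid X s).refl y)).trans ((le_iSup (fun x : X => Metric.ediam (component s x)) y).trans h)
  rw [edist_dist] at h1
  exact (ENNReal.ofReal_le_ofReal_iff hε).1 h1

theorem isClosed_component {s : ℝ} (hs : 0 < s) (x : X) : IsClosed (component s x) := by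
  rw [← isOpen_compl_iff, Metric.isOpen_iff]
  intro y hy
  refine ⟨s, hs, fun z hz hz' => hy ?_⟩
  have : chainSetoid X s y z := chainSetoid_of_dist_le (by rw [dist_comm]; exact (Metric.mem_ball.1 hz).le)
  exact (chainSetoid X s).trans this hz'

noncomputable section

/-- The number of `s`-connected components in the `s'`-connected component of `x`. -/
def chainIndex (s s' : ℝ) (x : X) : ℕ :=
  (Quotient.mk (chainSetoid X s) '' component s' x).ncard

end

theorem chainIndex_isometry {s s' : ℝ} (f : X ≃ᵢ X) (x : X) :
    chainIndex s s' (f x) = chainIndex s s' x := by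
  let F : Quotient (chainSetoid X s) → Quotient (chainSetoid X s) :=
    Quotient.map f fun a b h => chainSetoid_isometry f h
  have hF : Function.Injective F := by
    intro p q
    refine Quotient.inductionOn₂ p q fun a b h => ?_
    have h1 : chainSetoid X s (f a) (f b) := Quotient.exact h
    have h2 := chainSetoid_isometry f.symm h1
    simp only [IsometryEquiv.symm_apply_apply] at h2
    exact Quotient.sound h2
  rw [chainIndex, chainIndex,
    ← Set.ncard_image_of_injective (Quotient.mk (chainSetoid X s) '' component s' x) hF]
  congr 1
  ext q
  constructor
  · rintro ⟨y, hy, rfl⟩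
    refine ⟨Quotient.mk _ (f.symm y), ⟨f.symm y, ?_, rfl⟩, ?_⟩
    · have := chainSetoid_isometry f.symm (mem_component.1 hy)
      rwa [IsometryEquiv.symm_apply_apply] at this
    · change Quotient.mk (chainSetoid X s) (f (f.symm y)) = _
      rw [IsometryEquiv.apply_symm_apply]
  · rintro ⟨_, ⟨y, hy, rfl⟩, rfl⟩
    exact ⟨f y, chainSetoid_isometry f hy, rfl⟩

theorem chainIndex_eq (hh : IsIsometricallyHomogeneous X) {s s' : ℝ} (x y : X) :
    chainIndex s s' x = chainIndex s s' y := by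
  obtain ⟨f, rfl⟩ := hh y x
  exact chainIndex_isometry f y

theorem image_component (f : X ≃ᵢ X) (s : ℝ) (x : X) :
    f '' component s x = component s (f x) := by
  ext z
  constructor
  · rintro ⟨z, hz, rfl⟩
    exact chainSetoid_isometry f hz
  · intro hz
    refine ⟨f.symm z, ?_, f.apply_symm_apply z⟩
    have := chainSetoid_isometry f.symm (mem_component.1 hz)
    rwa [IsometryEquiv.symm_apply_apply] at this

theorem ncard_component_eq (hh : IsIsometricallyHomogeneous X) {s : ℝ} (x y : X) :
    (component s x).ncard = (component s y).ncard := by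
  obtain ⟨f, rfl⟩ := hh y x
  rw [← Set.ncard_image_of_injective (component s y) f.injective, image_component]

/-- As in Lagrange's theorem: the large component is a disjoint union of small ones, which are
equinumerous by homogeneity. -/
theorem ncard_component_mul (hh : IsIsometricallyHomogeneous X) {s s' : ℝ} (hs : s ≤ s') (x : X)
    (hfin : (component s' x).Finite) :
    (component s' x).ncard = chainIndex s s' x * (component s x).ncard := by
  classical
  have him : hfin.toFinset.image (Quotient.mk (chainSetoid X s)) =
      (hfin.image (Quotient.mk (chainSetoid X s))).toFinset := by
    ext; simp
  rw [Set.ncard_eq_toFinset_card _ hfin,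
    Finset.card_eq_sum_card_image (Quotient.mk (chainSetoid X s)), chainIndex,
    Set.ncard_eq_toFinset_card _ (hfin.image _), ← him, ← smul_eq_mul]
  refine Finset.sum_eq_card_nsmul fun q hq => ?_
  obtain ⟨y, hy, rfl⟩ := Finset.mem_image.1 hq
  rw [Set.Finite.mem_toFinset] at hy
  rw [ncard_component_eq hh x y, ← Set.ncard_coe_finset]
  congr 1
  ext z
  simp only [Finset.coe_filter, Set.Finite.mem_toFinset, Set.mem_ofPred_eq]
  constructor
  · exact fun h => Quotient.exact h.2
  · exact fun h => ⟨(chainSetoid X s').trans (chainSetoid_mono hs h) hy, Quotient.sound h⟩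

theorem IsProperUnbounded.isCompact_component (hp : IsProperUnbounded X) (hd : BiUniformDimZero X)
    {s : ℝ} (hs : 0 < s) (x : X) : IsCompact (component s x) := by
  obtain ⟨ε, hε, h⟩ := hd.2 s hs
  exact (hp.2 x ε hε.le).of_isClosed_subset (isClosed_component hs x)
    fun y hy => dist_le_of_chain hε.le h hy

/-- Finitely many `s`-balls cover the compact component, and each ball lies in one `s`-component. -/
theorem IsProperUnbounded.finite_classes (hp : IsProperUnbounded X) (hd : BiUniformDimZero X)
    {s s' : ℝ} (hs : 0 < s) (hs' : 0 < s') (x : X) :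
    (Quotient.mk (chainSetoid X s) '' component s' x).Finite := by
  obtain ⟨t, -, ht, hcov⟩ := (hp.isCompact_component hd hs' x).finite_cover_balls hs
  refine (ht.image (Quotient.mk (chainSetoid X s))).subset ?_
  rintro _ ⟨y, hy, rfl⟩
  obtain ⟨z, hz, hyz⟩ := Set.mem_iUnion₂.1 (hcov hy)
  exact ⟨z, hz, (Quotient.sound (chainSetoid_of_dist_le (Metric.mem_ball.1 hyz).le)).symm⟩

/-- Numbering of the classes of an equivalence relation in the classes of a coarser one. -/
theorem exists_class_labels {X : Type*} (E E' : Setoid X) (hE : ∀ x y, E x y → E' x y) {r : ℕ}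
    (hr : ∀ x, (Quotient.mk E '' {y | E' y x}).ncard = r)
    (hfin : ∀ x, (Quotient.mk E '' {y | E' y x}).Finite) (x₀ : X) :
    ∃ l : X → ℕ, (∀ x, l x < r) ∧ (∀ x y, E x y → l x = l y) ∧
      (∀ x y, E' x y → l x = l y → E x y) ∧ (∀ x, ∀ i < r, ∃ y, E' y x ∧ l y = i) ∧ l x₀ = 0 := by
  classical
  let F : Quotient E' → Set (Quotient E) := fun c => Quotient.mk E '' {y | E' y c.out}
  have hmem : ∀ x, Quotient.mk E x ∈ F (Quotient.mk E' x) :=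
    fun x => ⟨x, E'.symm (Quotient.mk_out x), rfl⟩
  have hex : ∀ c, ∃ e : F c ≃ Fin r, ∀ h : Quotient.mk E x₀ ∈ F c, (e ⟨_, h⟩ : ℕ) = 0 := by
    intro c
    have : Fintype (F c) := (hfin c.out).fintype
    have hcard : Fintype.card (F c) = r := by
      rw [← hr c.out, ← Nat.card_coe_set_eq, Nat.card_eq_fintype_card]
    by_cases h : Quotient.mk E x₀ ∈ F c
    · have hpos : 0 < r := hcard ▸ Fintype.card_pos_iff.2 ⟨⟨_, h⟩⟩
      obtain ⟨e, he⟩ := exists_equiv_of_card_eq (A := F c) (B := Fin r) (by simpa using hcard)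
        ⟨_, h⟩ ⟨0, hpos⟩
      exact ⟨e, fun _ => by rw [he]⟩
    · exact ⟨Fintype.equivFinOfCardEq hcard, fun h' => absurd h' h⟩
  choose e he using hex
  let l : X → ℕ := fun x => e (Quotient.mk E' x) ⟨Quotient.mk E x, hmem x⟩
  have key : ∀ (c : Quotient E') (x : X) (hc : Quotient.mk E' x = c)
      (h : Quotient.mk E x ∈ F c), l x = e c ⟨Quotient.mk E x, h⟩ := by
    rintro c x rfl h
    rfl
  refine ⟨l, fun x => Fin.is_lt _, fun x y hxy => ?_, fun x y hxy hl => ?_, fun x i hi => ?_, ?_⟩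
  · have h1 : Quotient.mk E' y = Quotient.mk E' x := Quotient.sound (hE _ _ (E.symm hxy))
    have h2 : Quotient.mk E x = Quotient.mk E y := Quotient.sound hxy
    rw [key _ y h1 (h2 ▸ hmem x)]
    simp only [l, h2]
  · have h1 : Quotient.mk E' y = Quotient.mk E' x := Quotient.sound (E'.symm hxy)
    rw [key _ y h1 (h1 ▸ hmem y)] at hl
    have h2 := (e _).injective (Fin.ext hl)
    exact Quotient.exact (congrArg Subtype.val h2)
  · obtain ⟨⟨_, y, hy, rfl⟩, hq⟩ := (e (Quotient.mk E' x)).surjective ⟨i, hi⟩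
    have hyx : E' y x := E'.trans hy (Quotient.mk_out x)
    refine ⟨y, hyx, ?_⟩
    rw [key _ y (Quotient.sound hyx) ⟨y, hy, rfl⟩, hq]
  · exact he _ _

/-- The coding given by the chain components at a sequence of scales. -/
theorem exists_isCoding_chainIndex (hp : IsProperUnbounded X) (hh : IsIsometricallyHomogeneous X)
    (hd : BiUniformDimZero X) {s : ℤ → ℝ} (hs : ∀ k, 0 < s k) (hs2 : ∀ k, 2 * s k ≤ s (k + 1))
    (x₀ : X) : ∃ c : X → ℤ → ℕ, IsCoding (fun k => chainIndex (s k) (s (k + 1)) x₀) c := by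
  have hmono : Monotone s := monotone_int_of_le_succ fun k => by linarith [hs k, hs2 k]
  have hup : ∀ n : ℕ, 2 ^ n * s 0 ≤ s n := by
    intro n
    induction n with
    | zero => simp
    | succ n ih =>
      have := hs2 n
      push_cast
      rw [pow_succ]
      linarith
  have hdown : ∀ n : ℕ, 2 ^ n * s (-n) ≤ s 0 := by
    intro n
    induction n with
    | zero => simp
    | succ n ih =>
      have h1 := hs2 (-(n + 1 : ℕ))
      have h2 : (-((n + 1 : ℕ) : ℤ) + 1) = -(n : ℤ) := by push_cast; ring
      rw [h2] at h1
      have h3 : (0 : ℝ) < 2 ^ n := by positivity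
      rw [pow_succ]
      nlinarith
  have hlarge : ∀ δ : ℝ, ∃ k, δ ≤ s k := by
    intro δ
    obtain ⟨n, hn⟩ := pow_unbounded_of_one_lt (δ / s 0) (one_lt_two)
    exact ⟨n, ((div_lt_iff₀ (hs 0)).1 hn).le.trans (hup n)⟩
  have hsmall : ∀ δ : ℝ, 0 < δ → ∃ k, s k ≤ δ := by
    intro δ hδ
    obtain ⟨n, hn⟩ := pow_unbounded_of_one_lt (s 0 / δ) (one_lt_two)
    have h1 := (div_lt_iff₀ hδ).1 hn
    have h3 : (0 : ℝ) < 2 ^ n := by positivity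
    exact ⟨-n, le_of_mul_le_mul_left ((hdown n).trans h1.le) h3⟩
  have hlab := fun k => exists_class_labels (chainSetoid X (s k)) (chainSetoid X (s (k + 1)))
    (fun x y => chainSetoid_mono (hmono (by omega))) (r := chainIndex (s k) (s (k + 1)) x₀)
    (fun x => chainIndex_eq hh x x₀) (fun x => hp.finite_classes hd (hs _) (hs _) x) x₀
  choose l hlt hl1 hl2 hl3 hl0 using hlab
  have agree_of_chain : ∀ {k x y}, chainSetoid X (s k) x y → ∀ i ≥ k, l i x = l i y :=
    fun h i hi => hl1 i _ _ (chainSetoid_mono (hmono hi) h)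
  have hall : ∀ x y, ∃ K, chainSetoid X (s K) x y := fun x y =>
    (hlarge (dist x y)).imp fun K hK => chainSetoid_of_dist_le hK
  have chain_of_agree : ∀ {k x y}, (∀ i ≥ k, l i x = l i y) → chainSetoid X (s k) x y := by
    intro k x y h
    obtain ⟨K, hK⟩ := hall x y
    refine descending_induction (P := fun k => chainSetoid X (s k) x y) K
      (fun i hi => chainSetoid_mono (hmono hi) hK) (fun i hi ih => hl2 i _ _ ih (h i hi)) k le_rfl
  have micro : ∀ ε : ℝ, 0 < ε → ∃ k, ∀ x y, (∀ i ≥ k, l i x = l i y) → dist x y ≤ ε := by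
    intro ε hε
    obtain ⟨δ, hδ, hm⟩ := hd.1 ε hε
    obtain ⟨k, hk⟩ := hsmall δ hδ
    exact ⟨k, fun x y h => dist_le_of_chain hε.le hm (chainSetoid_mono hk (chain_of_agree h))⟩
  refine ⟨fun x k => l k x, fun x y hxy => ?_, fun x k => hlt k x, fun x => ?_,
    fun a ha ⟨K, hK⟩ => ?_, micro, fun k => ⟨s k, hs k, fun x y h => ?_⟩, fun δ => ?_, fun k => ?_⟩
  · refine dist_le_zero.1 (le_of_forall_pos_le_add fun ε hε => ?_)
    obtain ⟨k, hk⟩ := micro ε hε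
    rw [zero_add]
    exact hk x y fun i _ => congrFun hxy i
  · obtain ⟨K, hK⟩ := hall x x₀
    exact ⟨K, fun k hk => (agree_of_chain hK k hk).trans (hl0 k)⟩
  · choose! g hg1 hg2 using hl3
    -- Keeping the point when its label is already right makes the constant `x₀` a solution above
    -- `K`; otherwise a point with the required label is taken in the same larger component.
    obtain ⟨z, hz, hzK⟩ := exists_descending
      (fun k x => if a k = l k x then x else g k x (a k)) (fun _ => x₀) K
      (fun k hk => by simp only [hK k hk, hl0 k, if_true])
    have hz1 : ∀ k, chainSetoid X (s (k + 1)) (z k) (z (k + 1)) := by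
      intro k
      rw [hz k]
      split_ifs
      · exact (chainSetoid X _).refl _
      · exact hg1 k _ _ (ha k)
    have hz2 : ∀ k, l k (z k) = a k := by
      intro k
      rw [hz k]
      split_ifs with h
      · exact h.symm
      · exact hg2 k _ _ (ha k)
    -- These components are compact and decreasing; a common point has all the required labels.
    let Z : ℕ → Set X := fun n => component (s (K - n)) (z (K - n))
    have hZ : ∀ n, Z (n + 1) ⊆ Z n := by
      intro n y hy
      have e : K - ((n + 1 : ℕ) : ℤ) + 1 = K - n := by push_cast; ring
      have h1 := hz1 (K - (n + 1 : ℕ))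
      rw [e] at h1
      exact (chainSetoid X _).trans (chainSetoid_mono (hmono (by omega)) (mem_component.1 hy)) h1
    obtain ⟨x, hx⟩ := IsCompact.nonempty_iInter_of_sequence_nonempty_isCompact_isClosed Z hZ
      (fun n => ⟨_, (chainSetoid X _).refl _⟩) (hp.isCompact_component hd (hs _) _)
      (fun n => isClosed_component (hs _) _)
    rw [Set.mem_iInter] at hx
    refine ⟨x, funext fun k => ?_⟩
    by_cases hk : K ≤ k
    · have h0 := mem_component.1 (hx 0)
      rw [Nat.cast_zero, sub_zero] at h0
      rw [hzK K le_rfl] at h0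
      change l k x = a k
      rw [agree_of_chain h0 k hk, hl0, hK k hk]
    · have h0 := mem_component.1 (hx (K - k).toNat)
      have e : K - ((K - k).toNat : ℤ) = k := by omega
      rw [e] at h0
      exact (agree_of_chain h0 k le_rfl).trans (hz2 k)
  · exact agree_of_chain (chainSetoid_of_dist_le h)
  · exact (hlarge δ).imp fun k hk x y h => agree_of_chain (chainSetoid_of_dist_le (h.trans hk))
  · obtain ⟨D, hD, hm⟩ := hd.2 (s k) (hs k)
    exact ⟨D, fun x y h => dist_le_of_chain hD.le hm (chain_of_agree h)⟩

/-- Every component contains many smaller ones at large scales. -/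
theorem exists_le_chainIndex_of_le (hp : IsProperUnbounded X) (hd : BiUniformDimZero X) {s : ℝ}
    (hs : 0 < s) (x : X) (N : ℕ) (M : ℝ) : ∃ s' ≥ M, N ≤ chainIndex s s' x := by
  classical
  have hinf : Infinite (Quotient (chainSetoid X s)) := by
    by_contra h
    rw [not_infinite_iff_finite] at h
    refine hp.1 ?_
    have : (Set.univ : Set X) = ⋃ q : Quotient (chainSetoid X s), component s q.out := by
      refine (Set.eq_univ_of_forall fun y => ?_).symm
      exact Set.mem_iUnion.2 ⟨Quotient.mk _ y, (chainSetoid X s).symm (Quotient.mk_out y)⟩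
    rw [this]
    refine (Bornology.isBounded_iUnion).2 fun q => ?_
    exact (hp.isCompact_component hd hs _).isBounded
  obtain ⟨T, hT⟩ := Infinite.exists_subset_card_eq (Quotient (chainSetoid X s)) N
  obtain ⟨R, hR⟩ : ∃ R : ℝ, ∀ q ∈ T, dist q.out x ≤ R :=
    (T.image fun q => dist q.out x).exists_le.imp fun R h q hq => h _ (Finset.mem_image_of_mem _ hq)
  refine ⟨max (max M s) R, le_trans (le_max_left _ _) (le_max_left _ _), ?_⟩
  rw [chainIndex, ← hT, ← Set.ncard_coe_finset]
  refine Set.ncard_le_ncard (fun q hq => ?_) (hp.finite_classes hd hs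
    (lt_of_lt_of_le hs ((le_max_right _ _).trans (le_max_left _ _))) x)
  exact ⟨q.out, chainSetoid_of_dist_le ((hR q hq).trans (le_max_right _ _)), Quotient.out_eq q⟩

/-- An infinite component contains many components at small scales. -/
theorem exists_le_chainIndex_of_infinite (hp : IsProperUnbounded X) (hd : BiUniformDimZero X)
    {s' : ℝ} (hs' : 0 < s') (x : X) (hinf : (component s' x).Infinite) (N : ℕ) {M : ℝ}
    (hM : 0 < M) : ∃ s, 0 < s ∧ s ≤ M ∧ N ≤ chainIndex s s' x := by
  classical
  obtain ⟨T, hT, hTN⟩ := hinf.exists_subset_card_eq N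
  obtain ⟨ε, hε, hTε⟩ : ∃ ε : ℝ, 0 < ε ∧ ∀ y ∈ T, ∀ z ∈ T, dist y z ≤ ε → y = z := by
    rcases T.offDiag.eq_empty_or_nonempty with h | h
    · refine ⟨1, one_pos, fun y hy z hz _ => ?_⟩
      by_contra hyz
      exact Finset.notMem_empty (y, z) (h ▸ Finset.mem_offDiag.2 ⟨hy, hz, hyz⟩)
    · obtain ⟨p, hp, hmin⟩ := T.offDiag.exists_min_image (fun p => dist p.1 p.2) h
      have hpos : 0 < dist p.1 p.2 := dist_pos.2 (Finset.mem_offDiag.1 hp).2.2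
      refine ⟨dist p.1 p.2 / 2, half_pos hpos, fun y hy z hz hyz => ?_⟩
      by_contra hne
      have := hmin (y, z) (Finset.mem_offDiag.2 ⟨hy, hz, hne⟩)
      simp only at this
      linarith
  obtain ⟨δ, hδ, hm⟩ := hd.1 ε hε
  have hpos : 0 < min δ M := lt_min hδ hM
  refine ⟨min δ M, hpos, min_le_right _ _, ?_⟩
  have hinj : Set.InjOn (Quotient.mk (chainSetoid X (min δ M))) T := fun y hy z hz hyz =>
    hTε y hy z hz (dist_le_of_chain hε.le hm (chainSetoid_mono (min_le_left _ _)
      (Quotient.exact hyz)))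
  rw [← hTN, ← Set.ncard_coe_finset, ← hinj.ncard_image, chainIndex]
  exact Set.ncard_le_ncard (Set.image_mono hT) (hp.finite_classes hd hpos hs' x)

end Chains

/-! ### The Cantor bi-cube -/

namespace CantorBiCube

theorem dist_le_of_agree {x y : CantorBiCube} {k : ℤ} (h : ∀ i ≥ k, x.1 i = y.1 i) :
    dist x y ≤ (2 : ℝ) ^ k := by
  refine ciSup_le fun i => ?_
  unfold term
  by_cases hi : k ≤ i
  · rw [h i hi]
    simp only [sub_self, abs_zero, mul_zero]
    positivity
  · have h1 : |((x.1 i : ℕ) : ℝ) - ((y.1 i : ℕ) : ℝ)| ≤ 1 := by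
      generalize x.1 i = a
      generalize y.1 i = b
      fin_cases a <;> fin_cases b <;> simp
    calc (2 : ℝ) ^ i * |((x.1 i : ℕ) : ℝ) - ((y.1 i : ℕ) : ℝ)| ≤ (2 : ℝ) ^ i * 1 := by gcongr
      _ ≤ _ := by
        rw [mul_one]
        exact zpow_le_zpow_right₀ (by norm_num) (by omega)

theorem agree_of_dist_lt {x y : CantorBiCube} {k : ℤ} (h : dist x y < (2 : ℝ) ^ k) :
    ∀ i ≥ k, x.1 i = y.1 i := by
  intro i hi
  by_contra hne
  have h1 : 1 ≤ |((x.1 i : ℕ) : ℝ) - ((y.1 i : ℕ) : ℝ)| := by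
    revert hne
    generalize x.1 i = a
    generalize y.1 i = b
    fin_cases a <;> fin_cases b <;> simp
  have h2 : term x y i ≤ dist x y := le_ciSup (bddAbove_term x y) i
  have h3 : (2 : ℝ) ^ k ≤ (2 : ℝ) ^ i := zpow_le_zpow_right₀ (by norm_num) hi
  have h4 : (2 : ℝ) ^ i * 1 ≤ term x y i := by
    unfold term
    gcongr
  linarith

/-- The coding of the Cantor bi-cube by blocks of consecutive digits. -/
theorem exists_isCoding {e : ℤ → ℤ} (he : ∀ k, e k < e (k + 1)) :
    ∃ c : CantorBiCube → ℤ → ℕ, IsCoding (fun k => 2 ^ (e (k + 1) - e k).toNat) c := by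
  have hmono : StrictMono e := strictMono_int_of_lt_succ he
  -- Thus `e` grows at least as fast as the identity, and the blocks `[e k, e (k + 1))` exhaust `ℤ`.
  have hmono' : Monotone fun k => e k - k := monotone_int_of_le_succ fun k => by
    have := he k
    omega
  have hblock : ∀ i, ∃ k, e k ≤ i ∧ i < e (k + 1) := by
    intro i
    obtain ⟨k, hk, hmax⟩ := Int.exists_greatest_of_bdd (P := fun k => e k ≤ i)
      ⟨max 0 (i - e 0), fun k hk => by
        by_contra! h
        have := hmono' (show (0 : ℤ) ≤ k by omega)
        simp only at this
        omega⟩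
      ⟨min 0 (i - e 0), by
        have := hmono' (show min 0 (i - e 0) ≤ 0 by omega)
        simp only at this
        omega⟩
    refine ⟨k, hk, ?_⟩
    by_contra! h
    have := hmax _ h
    omega
  have huniq : ∀ {i k k'}, e k ≤ i → i < e (k + 1) → e k' ≤ i → i < e (k' + 1) → k = k' := by
    intro i k k' h1 h2 h3 h4
    have h5 := hmono.lt_iff_lt.1 (h1.trans_lt h4)
    have h6 := hmono.lt_iff_lt.1 (h3.trans_lt h2)
    omega
  let m : ℤ → ℕ := fun k => (e (k + 1) - e k).toNat
  have hm : ∀ k, (m k : ℤ) = e (k + 1) - e k := fun k => by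
    have := he k
    simp only [m]
    omega
  let c : CantorBiCube → ℤ → ℕ := fun x k =>
    finFunctionFinEquiv (fun j : Fin (m k) => x.1 (e k + (j : ℕ)))
  have hc1 : ∀ {x y : CantorBiCube} {k}, (∀ i ≥ e k, x.1 i = y.1 i) → ∀ i ≥ k, c x i = c y i := by
    intro x y k h i hi
    simp only [c]
    congr 2
    funext j
    refine h _ ?_
    have := hmono.monotone hi
    omega
  have hc2 : ∀ {x y : CantorBiCube} {k}, (∀ i ≥ k, c x i = c y i) → ∀ i ≥ e k, x.1 i = y.1 i := by
    intro x y k h i hi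
    obtain ⟨k', h1, h2⟩ := hblock i
    have h3 : k < k' + 1 := hmono.lt_iff_lt.1 (lt_of_le_of_lt hi h2)
    have h4 := finFunctionFinEquiv.injective (Fin.ext (h k' (by omega)))
    have h5 := congrFun h4 ⟨(i - e k').toNat, by have := hm k'; omega⟩
    have h6 : e k' + ((i - e k').toNat : ℤ) = i := by omega
    simpa only [h6] using h5
  have hlow : ∀ N, ∃ k, e k ≤ N := fun N => (hblock N).imp fun k hk => hk.1
  have hhigh : ∀ N, ∃ k, N ≤ e k := fun N =>
    let ⟨k, hk⟩ := hblock N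
    ⟨k + 1, hk.2.le⟩
  refine ⟨c, fun x y hxy => ?_, fun x k => Fin.is_lt _, fun x => ?_, fun l hl ⟨K, hK⟩ => ?_,
    fun ε hε => ?_, fun k => ⟨2 ^ e k / 2, by positivity, fun x y h => ?_⟩, fun δ => ?_,
    fun k => ⟨2 ^ e k, fun x y h => dist_le_of_agree (hc2 h)⟩⟩
  · refine Subtype.ext (funext fun i => ?_)
    obtain ⟨k, hk⟩ := hlow i
    exact hc2 (k := k) (fun i _ => congrFun hxy i) i hk
  · obtain ⟨n, hn⟩ := x.2
    obtain ⟨K, hK⟩ := hhigh (n + 1)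
    refine ⟨K, fun k hk => ?_⟩
    have : ∀ j : Fin (m k), x.1 (e k + (j : ℕ)) = 0 := fun j => hn _ (by
      have := hmono.monotone hk
      omega)
    simp [c, this, finFunctionFinEquiv]
  · let b : ℤ → ℕ → Fin 2 := fun k j =>
      if h : j < m k then finFunctionFinEquiv.symm ⟨l k, hl k⟩ ⟨j, h⟩ else 0
    choose κ hκ1 hκ2 using hblock
    have hb0 : ∀ k ≥ K, ∀ j, b k j = 0 := by
      intro k hk j
      simp only [b]
      split_ifs
      · simp [finFunctionFinEquiv, hK k hk]
      · rfl
    refine ⟨⟨fun i => b (κ i) (i - e (κ i)).toNat, (e K).toNat, fun i hi => hb0 _ ?_ _⟩,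
      funext fun k => ?_⟩
    · have h1 : e K < e (κ i + 1) := by
        have := hκ2 i
        omega
      have := hmono.lt_iff_lt.1 h1
      omega
    · have : ∀ j : Fin (m k), b (κ (e k + (j : ℕ))) (e k + (j : ℕ) - e (κ (e k + (j : ℕ)))).toNat =
          finFunctionFinEquiv.symm ⟨l k, hl k⟩ j := by
        intro j
        have h1 : κ (e k + (j : ℕ)) = k := by
          refine huniq (hκ1 _) (hκ2 _) (by omega) ?_
          have := hm k
          have := j.2
          omega
        rw [h1]
        have h2 : (e k + (j : ℕ) - e k).toNat = j := by omega
        rw [h2]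
        simp [b]
      simp only [c, this]
      simp
  · obtain ⟨N, hN⟩ := exists_mem_Ico_zpow hε (one_lt_two (α := ℝ))
    obtain ⟨k, hk⟩ := hlow N
    refine ⟨k, fun x y h => (dist_le_of_agree (hc2 h)).trans (le_trans ?_ hN.1)⟩
    exact zpow_le_zpow_right₀ (by norm_num) hk
  · refine hc1 (agree_of_dist_lt (h.trans_lt ?_))
    have : (0 : ℝ) < 2 ^ e k := by positivity
    linarith
  · obtain ⟨N, hN⟩ := pow_unbounded_of_one_lt δ (one_lt_two (α := ℝ))
    obtain ⟨k, hk⟩ := hhigh N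
    refine ⟨k, fun x y h => hc1 (agree_of_dist_lt (h.trans_lt (hN.trans_le ?_)))⟩
    rw [← zpow_natCast]
    exact zpow_le_zpow_right₀ (by norm_num) hk

end CantorBiCube

/-! ### Uncountable spaces -/

/-- There are only countably many `s`-components, as each ball around `x` meets finitely many; were
one finite, all would be, and `X` would be countable. -/
theorem infinite_component_of_uncountable {X : Type*} [MetricSpace X] [Uncountable X]
    (hp : IsProperUnbounded X) (hh : IsIsometricallyHomogeneous X) (hd : BiUniformDimZero X)
    {s : ℝ} (hs : 0 < s) (x : X) : (component s x).Infinite := by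
  intro hfin
  have hfin' : ∀ y : X, (component s y).Finite := by
    intro y
    obtain ⟨f, rfl⟩ := hh x y
    rw [← image_component]
    exact hfin.image _
  have hQ : (Set.univ : Set (Quotient (chainSetoid X s))) ⊆
      ⋃ n : ℕ, Quotient.mk (chainSetoid X s) '' component (n + 1) x := by
    intro q _
    obtain ⟨n, hn⟩ := exists_nat_ge (dist q.out x)
    have h : chainSetoid X ((n : ℝ) + 1) q.out x := chainSetoid_of_dist_le (by linarith)
    exact Set.mem_iUnion.2 ⟨n, q.out, h, q.out_eq⟩
  have hQc : (Set.univ : Set (Quotient (chainSetoid X s))).Countable :=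
    (Set.countable_iUnion fun n => (hp.finite_classes hd hs (by positivity) x).countable).mono hQ
  have : Countable (Quotient (chainSetoid X s)) := Set.countable_univ_iff.1 hQc
  have hX : (Set.univ : Set X) ⊆ ⋃ q : Quotient (chainSetoid X s), component s q.out :=
    fun y _ => Set.mem_iUnion.2
      ⟨Quotient.mk _ y, (chainSetoid X s).symm (Quotient.mk_out y)⟩
  exact not_countable (α := X)
    (Set.countable_univ_iff.1 ((Set.countable_iUnion fun q => (hfin' _).countable).mono hX))

/-- With `r ≥ 4 * a * b` the quotients `r / a` and `r / b` are far enough apart that `p = r / b + 2`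
is less than `q = r / a`. For `M = 2 ^ m` large, the interval from `M / q` to `M / p` then contains
integers `a' < b'`. -/
theorem exists_regrouping_up {a b r : ℕ} (ha : 1 ≤ a) (hab : a < b) (hr : 4 * a * b ≤ r) :
    ∃ m p q a' b' : ℕ, 1 ≤ m ∧ 1 ≤ a' ∧ a' < b' ∧ 1 ≤ p ∧ b' * p ≤ 2 ^ m ∧ 2 ^ m ≤ a' * q ∧
      a + (q - 1) * a ≤ r ∧ r ≤ a + (p - 1) * b := by
  have hb : 0 < b := by omega
  have hP1 := Nat.div_mul_le_self r b
  have hP2 := Nat.lt_div_mul_add (a := r) hb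
  have hQ1 := Nat.div_mul_le_self r a
  have hQ2 := Nat.lt_div_mul_add (a := r) ha
  obtain ⟨P, hP⟩ : ∃ P, r / b = P := ⟨_, rfl⟩
  obtain ⟨Q, hQ⟩ : ∃ Q, r / a = Q := ⟨_, rfl⟩
  rw [hP] at hP1 hP2
  rw [hQ] at hQ1 hQ2
  have hPQ : P + 2 < Q := by
    by_contra! h
    have h1 : r < (P + 3) * a := by nlinarith
    have h2 : r * b < (P + 3) * a * b := by nlinarith
    have h3 : P * b * a ≤ r * a := Nat.mul_le_mul_right _ hP1
    have h4 : r * (a + 1) ≤ r * b := Nat.mul_le_mul_left _ hab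
    nlinarith [Nat.mul_pos ha hb]
  obtain ⟨p, hp⟩ : ∃ p, P + 2 = p := ⟨_, rfl⟩
  have hM : 2 * p * Q < 2 ^ (2 * p * Q) := Nat.lt_two_pow_self
  obtain ⟨M, hMdef⟩ : ∃ M, 2 ^ (2 * p * Q) = M := ⟨_, rfl⟩
  have hppos : 0 < p := by omega
  have hQpos : 0 < Q := by omega
  have hB1 := Nat.div_mul_le_self M p
  have hB2 := Nat.lt_div_mul_add (a := M) hppos
  have hA1 := Nat.div_mul_le_self M Q
  have hA2 := Nat.lt_div_mul_add (a := M) hQpos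
  refine ⟨2 * p * Q, p, Q, M / Q + 1, M / p, ?_, Nat.succ_pos _, ?_, hppos, ?_, ?_, ?_, ?_⟩
  · nlinarith [Nat.mul_pos hppos hQpos]
  · generalize M / Q = A at *
    generalize M / p = B at *
    by_contra! h
    have h1 : M < (A + 2) * p := by nlinarith
    have h2 : M * Q < (A + 2) * p * Q := by nlinarith
    have h3 : A * Q * p ≤ M * p := Nat.mul_le_mul_right _ hA1
    have h4 : M * (p + 1) ≤ M * Q := Nat.mul_le_mul_left _ (by omega)
    nlinarith
  · rw [hMdef]
    exact hB1
  · rw [hMdef]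
    nlinarith
  · obtain ⟨Q', rfl⟩ : ∃ Q', Q = Q' + 1 := ⟨Q - 1, by omega⟩
    rw [Nat.add_sub_cancel]
    nlinarith
  · rw [← hp, show P + 2 - 1 = P + 1 by omega]
    nlinarith

/-- Here `m`, `p`, `q` depend only on the sizes one level higher, so `r` may be chosen after `q`.
Since `p ≥ 2`, one further part can absorb everything: `a = r / q` and any `b` exceeding `r`
suffice. -/
theorem exists_regrouping_down {a' b' : ℕ} (ha' : 1 ≤ a') (hb' : a' < b') :
    ∃ m p q : ℕ, 1 ≤ m ∧ 1 ≤ p ∧ b' * p ≤ 2 ^ m ∧ 2 ^ m ≤ a' * q ∧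
      ∀ r ≥ q, ∃ a b : ℕ, 1 ≤ a ∧ a < b ∧ a + (q - 1) * a ≤ r ∧ r ≤ a + (p - 1) * b := by
  have hM : 2 * b' < 2 ^ (2 * b') := Nat.lt_two_pow_self
  have hb0 : 0 < b' := by omega
  obtain ⟨M, hMdef⟩ : ∃ M, 2 ^ (2 * b') = M := ⟨_, rfl⟩
  have hp : 2 ≤ M / b' := (Nat.le_div_iff_mul_le hb0).2 (by omega)
  have hA2 := Nat.lt_div_mul_add (a := M) ha'
  refine ⟨2 * b', M / b', M / a' + 1, by omega, by omega, ?_, ?_, fun r hr => ?_⟩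
  · rw [hMdef, mul_comm]
    exact Nat.div_mul_le_self M b'
  · rw [hMdef]
    nlinarith
  · have hr1 := Nat.div_mul_le_self r (M / a' + 1)
    refine ⟨r / (M / a' + 1), r + r / (M / a' + 1) + 1, ?_, ?_, ?_, ?_⟩
    · exact (Nat.le_div_iff_mul_le (Nat.succ_pos _)).2 (by omega)
    · generalize r / (M / a' + 1) = A
      omega
    · rw [Nat.add_sub_cancel]
      nlinarith
    · have : 1 * (r + r / (M / a' + 1) + 1) ≤ (M / b' - 1) * (r + r / (M / a' + 1) + 1) :=
        Nat.mul_le_mul_right _ (by omega)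
      generalize r / (M / a' + 1) = A at *
      generalize (M / b' - 1) * (r + A + 1) = B at *
      omega

theorem biUniformlyEquivalent_cantorBiCube {X : Type*} [MetricSpace X] [Uncountable X]
    (hp : IsProperUnbounded X) (hh : IsIsometricallyHomogeneous X) (hd : BiUniformDimZero X) :
    BiUniformlyEquivalent X CantorBiCube := by
  obtain ⟨x₀⟩ : Nonempty X := inferInstance
  -- A state consists of a scale of `X`, the start of a block of binary places, and the bounds for
  -- the cluster sizes at this level.
  let V : ℝ × ℤ × ℕ × ℕ → Prop := fun ⟨s, _, a, b⟩ => 0 < s ∧ 1 ≤ a ∧ a < b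
  let S : ℝ × ℤ × ℕ × ℕ → ℝ × ℤ × ℕ × ℕ → Prop := fun ⟨s, e, a, b⟩ ⟨s', e', a', b'⟩ =>
    (0 < s ∧ 1 ≤ a ∧ a < b) ∧ 2 * s ≤ s' ∧ e < e' ∧ ∃ p q, 1 ≤ p ∧
      b' * p ≤ 2 ^ (e' - e).toNat ∧ 2 ^ (e' - e).toNat ≤ a' * q ∧
      a + (q - 1) * a ≤ chainIndex s s' x₀ ∧ chainIndex s s' x₀ ≤ a + (p - 1) * b
  have up : ∀ x, V x → ∃ y, V y ∧ S x y := by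
    rintro ⟨s, e, a, b⟩ ⟨hs, ha, hab⟩
    obtain ⟨s', hs', hr⟩ := exists_le_chainIndex_of_le hp hd hs x₀ (4 * a * b) (2 * s)
    obtain ⟨m, p, q, a', b', hm, ha', hab', h1, h2, h3, h4, h5⟩ := exists_regrouping_up ha hab hr
    have he : (e + m - e).toNat = m := by omega
    refine ⟨(s', e + m, a', b'), ⟨by linarith, ha', hab'⟩, ⟨hs, ha, hab⟩, hs', by omega, p, q, h1,
      ?_, ?_, h4, h5⟩
    · rwa [he]
    · rwa [he]
  have down : ∀ x, V x → ∃ y, V y ∧ S y x := by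
    rintro ⟨s', e', a', b'⟩ ⟨hs', ha', hab'⟩
    obtain ⟨m, p, q, hm, h1, h2, h3, h⟩ := exists_regrouping_down ha' hab'
    obtain ⟨s, hs, hss', hr⟩ := exists_le_chainIndex_of_infinite hp hd hs' x₀
      (infinite_component_of_uncountable hp hh hd hs' x₀) q (half_pos hs')
    obtain ⟨a, b, ha, hab, h4, h5⟩ := h _ hr
    have he : (e' - (e' - m)).toNat = m := by omega
    refine ⟨(s, e' - m, a, b), ⟨hs, ha, hab⟩, ⟨hs, ha, hab⟩, by linarith, by omega, p, q, h1,
      ?_, ?_, h4, h5⟩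
    · rwa [he]
    · rwa [he]
  obtain ⟨f, hf⟩ := exists_biinfinite_chain S V V up down (1, 0, 1, 2) (by simp [V]) (by simp [V])
  obtain ⟨c, hc⟩ := exists_isCoding_chainIndex hp hh hd (s := fun k => (f k).1)
    (fun k => (hf k).1.1) (fun k => (hf k).2.1) x₀
  choose p q hp' h1 h2 h3 h4 using fun k => (hf k).2.2.2
  obtain ⟨d, hd'⟩ := hc.exists_recoding (a := fun k => (f k).2.2.1) (w := fun k => (f k).2.2.1)
    (b := fun k => (f k).2.2.2) (fun k => (hf k).1.2.1) (fun k => le_rfl)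
    (fun k => (hf k).1.2.2.le) hp' h1 h2 h3 h4
  obtain ⟨g, hg⟩ := CantorBiCube.exists_isCoding (e := fun k => (f k).2.1)
    (fun k => (hf k).2.2.1)
  exact hd'.biUniformlyEquivalent hg

/-! ### Countable spaces -/

section Countable

variable {X : Type*} [MetricSpace X]

theorem IsProperUnbounded.nonempty (hp : IsProperUnbounded X) : Nonempty X := by
  by_contra h
  rw [not_nonempty_iff] at h
  exact hp.1 (Set.eq_empty_of_isEmpty (Set.univ : Set X) ▸ Bornology.isBounded_empty)

theorem IsProperUnbounded.properSpace (hp : IsProperUnbounded X) : ProperSpace X := by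
  refine ⟨fun x r => ?_⟩
  by_cases hr : 0 ≤ r
  · exact hp.2 x r hr
  · rw [Metric.closedBall_eq_empty.2 (not_le.1 hr)]
    exact isCompact_empty

/-- By Baire's theorem a countable complete space has an isolated point, and homogeneity moves its
isolating ball everywhere. -/
theorem exists_discrete_scale [Countable X] (hp : IsProperUnbounded X)
    (hh : IsIsometricallyHomogeneous X) : ∃ s : ℝ, 0 < s ∧ ∀ x y : X, dist x y ≤ s → x = y := by
  have := hp.nonempty
  have := hp.properSpace
  obtain ⟨x, hx⟩ := nonempty_interior_of_iUnion_of_closed (f := fun x : X => ({x} : Set X))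
    (fun x => isClosed_singleton) (Set.iUnion_of_singleton X)
  have hx' : x ∈ interior ({x} : Set X) := by
    obtain ⟨y, hy⟩ := hx
    have : y = x := Set.mem_singleton_iff.1 (interior_subset hy)
    rwa [this] at hy
  obtain ⟨ε, hε, h⟩ := Metric.mem_nhds_iff.1 (mem_interior_iff_mem_nhds.1 hx')
  refine ⟨ε / 2, half_pos hε, fun y z hyz => ?_⟩
  obtain ⟨f, rfl⟩ := hh x y
  have h1 : f.symm z ∈ Metric.ball x ε := by
    rw [Metric.mem_ball, ← f.isometry.dist_eq, f.apply_symm_apply, dist_comm]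
    linarith
  have h2 : f.symm z = x := h h1
  rw [← h2, f.apply_symm_apply]

theorem eq_of_chain_of_discrete {s : ℝ} (hs : ∀ x y : X, dist x y ≤ s → x = y) {x y : X}
    (h : chainSetoid X s x y) : x = y := by
  induction h with
  | refl => rfl
  | tail _ h ih => exact ih.trans (hs _ _ h)

theorem component_of_discrete {s : ℝ} (hs : ∀ x y : X, dist x y ≤ s → x = y) (x : X) :
    component s x = {x} := by
  ext y
  constructor
  · exact fun h => eq_of_chain_of_discrete hs h
  · rintro rfl
    exact (chainSetoid X s).refl _

theorem finite_component [Countable X] (hp : IsProperUnbounded X)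
    (hh : IsIsometricallyHomogeneous X) (hd : BiUniformDimZero X) {s : ℝ} (hs : 0 < s) (x : X) :
    (component s x).Finite := by
  obtain ⟨s₀, hs₀, h⟩ := exists_discrete_scale hp hh
  refine Set.Finite.of_finite_image (hp.finite_classes hd hs₀ hs x) fun y _ z _ hyz => ?_
  exact eq_of_chain_of_discrete h (Quotient.exact hyz)

theorem ncard_component_pos [Countable X] (hp : IsProperUnbounded X)
    (hh : IsIsometricallyHomogeneous X) (hd : BiUniformDimZero X) {s : ℝ} (hs : 0 < s) (x : X) :
    0 < (component s x).ncard :=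
  (Set.ncard_pos (finite_component hp hh hd hs x)).2 ⟨x, (chainSetoid X s).refl x⟩

theorem ncard_component_dvd [Countable X] (hp : IsProperUnbounded X)
    (hh : IsIsometricallyHomogeneous X) (hd : BiUniformDimZero X) {s s' : ℝ} (hs : 0 < s)
    (hss' : s ≤ s') (x : X) : (component s x).ncard ∣ (component s' x).ncard :=
  Dvd.intro_left _ (ncard_component_mul hh hss' x
    (finite_component hp hh hd (hs.trans_le hss') x)).symm

/-- Countable spaces are bi-uniformly equivalent if the cardinalities of their components are
cofinal in each other for divisibility. -/
theorem biUniformlyEquivalent_of_dvd {Y : Type*} [MetricSpace Y] [Countable X] [Countable Y]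
    (hpX : IsProperUnbounded X) (hhX : IsIsometricallyHomogeneous X) (hdX : BiUniformDimZero X)
    (hpY : IsProperUnbounded Y) (hhY : IsIsometricallyHomogeneous Y) (hdY : BiUniformDimZero Y)
    (x₀ : X) (y₀ : Y)
    (hXY : ∀ s : ℝ, 0 < s → ∃ t : ℝ, 0 < t ∧ (component s x₀).ncard ∣ (component t y₀).ncard)
    (hYX : ∀ t : ℝ, 0 < t → ∃ s : ℝ, 0 < s ∧ (component t y₀).ncard ∣ (component s x₀).ncard) :
    BiUniformlyEquivalent X Y := by
  obtain ⟨s₀, hs₀, hs⟩ := exists_discrete_scale hpX hhX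
  obtain ⟨t₀, ht₀, ht⟩ := exists_discrete_scale hpY hhY
  let cX : ℝ → ℕ := fun s => (component s x₀).ncard
  let cY : ℝ → ℕ := fun t => (component t y₀).ncard
  have hcX : ∀ {s}, s ≤ s₀ → cX s = 1 := by
    intro s h
    simp only [cX]
    rw [component_of_discrete (fun x y hxy => hs x y (hxy.trans h)), Set.ncard_singleton]
  have hcY : ∀ {t}, t ≤ t₀ → cY t = 1 := by
    intro t h
    simp only [cY]
    rw [component_of_discrete (fun x y hxy => ht x y (hxy.trans h)), Set.ncard_singleton]
  -- The cardinalities are interleaved: `cX s ∣ cY t ∣ cX s' ∣ cY t'`. Below the discrete scales all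
  -- of them are 1, so halving continues the chain downwards.
  let S : ℝ × ℝ → ℝ × ℝ → Prop := fun p p' => (0 < p.1 ∧ 0 < p.2 ∧ cX p.1 ∣ cY p.2) ∧
    2 * p.1 ≤ p'.1 ∧ 2 * p.2 ≤ p'.2 ∧ cY p.2 ∣ cX p'.1
  let U : ℝ × ℝ → Prop := fun p => 0 < p.1 ∧ 0 < p.2 ∧ cX p.1 ∣ cY p.2
  let D : ℝ × ℝ → Prop := fun p => (0 < p.1 ∧ p.1 ≤ s₀) ∧ (0 < p.2 ∧ p.2 ≤ t₀)
  have up : ∀ p, U p → ∃ p', U p' ∧ S p p' := by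
    rintro ⟨s, t⟩ ⟨hs, ht, hst⟩
    obtain ⟨s', hs', h1⟩ := hYX t ht
    have hs2 : 0 < max s' (2 * s) := lt_max_of_lt_left hs'
    obtain ⟨t', ht', h2⟩ := hXY _ hs2
    refine ⟨(max s' (2 * s), max t' (2 * t)), ⟨hs2, lt_max_of_lt_left ht', ?_⟩, ⟨hs, ht, hst⟩,
      le_max_right _ _, le_max_right _ _, ?_⟩
    · exact h2.trans (ncard_component_dvd hpY hhY hdY ht' (le_max_left _ _) _)
    · exact h1.trans (ncard_component_dvd hpX hhX hdX hs' (le_max_left _ _) _)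
  have down : ∀ p, D p → ∃ p', D p' ∧ S p' p := by
    rintro ⟨s, t⟩ ⟨⟨hs, hs'⟩, ht, ht'⟩
    simp only at hs hs' ht ht'
    refine ⟨(s / 2, t / 2), ⟨⟨half_pos hs, ?_⟩, half_pos ht, ?_⟩, ⟨half_pos hs, half_pos ht, ?_⟩,
      ?_, ?_, ?_⟩ <;> simp only
    · linarith
    · linarith
    · rw [hcX (by linarith)]
      exact one_dvd _
    · linarith
    · linarith
    · rw [hcY (by linarith)]
      exact one_dvd _
  obtain ⟨f, hf⟩ := exists_biinfinite_chain S U D up down (s₀, t₀)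
    ⟨hs₀, ht₀, by simp only; rw [hcX le_rfl]; exact one_dvd _⟩ ⟨⟨hs₀, le_rfl⟩, ht₀, le_rfl⟩
  obtain ⟨c, hc⟩ := exists_isCoding_chainIndex hpX hhX hdX (s := fun k => (f k).1)
    (fun k => (hf k).1.1) (fun k => (hf k).2.1) x₀
  obtain ⟨d, hd⟩ := exists_isCoding_chainIndex hpY hhY hdY (s := fun k => (f k).2)
    (fun k => (hf k).1.2.1) (fun k => (hf k).2.2.1) y₀
  have hX : ∀ k, 0 < cX (f k).1 := fun k => ncard_component_pos hpX hhX hdX (hf k).1.1 _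
  have hY : ∀ k, 0 < cY (f k).2 := fun k => ncard_component_pos hpY hhY hdY (hf k).1.2.1 _
  -- With `w = cY / cX` at one level and `q` the quotient from `cY` to the next `cX`, the digit
  -- numbers are `w k * q k` for `X` and `w (k + 1) * q k` for `Y`. Hence clusters of constant size
  -- `w k`, `q k` of them in each group, fit exactly.
  choose w hw using fun k => (hf k).1.2.2
  choose q hq using fun k => (hf k).2.2.2
  have hw1 : ∀ k, 1 ≤ w k := fun k => Nat.pos_of_ne_zero fun h => by
    have := hY k
    rw [hw k, h] at this
    simp at this
  have hq1 : ∀ k, 1 ≤ q k := fun k => Nat.pos_of_ne_zero fun h => by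
    have := hX (k + 1)
    rw [hq k, h] at this
    simp at this
  have hr : ∀ k, chainIndex (f k).1 (f (k + 1)).1 x₀ = w k * q k := by
    intro k
    have h1 : cX (f (k + 1)).1 = chainIndex (f k).1 (f (k + 1)).1 x₀ * cX (f k).1 :=
      ncard_component_mul hhX (by linarith [(hf k).2.1, (hf k).1.1]) x₀
        (finite_component hpX hhX hdX (hf (k + 1)).1.1 x₀)
    rw [hq k, hw k] at h1
    refine Nat.eq_of_mul_eq_mul_right (hX k) ?_
    rw [← h1]
    ring
  have hn : ∀ k, chainIndex (f k).2 (f (k + 1)).2 y₀ = w (k + 1) * q k := by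
    intro k
    have h1 : cY (f (k + 1)).2 = chainIndex (f k).2 (f (k + 1)).2 y₀ * cY (f k).2 :=
      ncard_component_mul hhY (by linarith [(hf k).2.2.1, (hf k).1.2.1]) y₀
        (finite_component hpY hhY hdY (hf (k + 1)).1.2.1 y₀)
    rw [hw (k + 1), hq k] at h1
    refine Nat.eq_of_mul_eq_mul_right (hY k) ?_
    rw [← h1]
    ring
  have hwq : ∀ k, w k + (q k - 1) * w k = w k * q k := by
    intro k
    obtain ⟨m, hm⟩ : ∃ m, q k = m + 1 := ⟨q k - 1, by have := hq1 k; omega⟩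
    rw [hm, Nat.add_sub_cancel]
    ring
  obtain ⟨c', hc'⟩ := hc.exists_recoding (a := w) (w := w) (b := w) (p := q) (q := q) hw1
    (fun _ => le_rfl) (fun _ => le_rfl) hq1 (fun k => (hn k).ge) (fun k => (hn k).le)
    (fun k => by rw [hwq, hr]) (fun k => by rw [hwq, hr])
  exact hc'.biUniformlyEquivalent hd

/-- Only finitely many prime powers divide `M`, and a scale beyond all the corresponding ones serves
them together. -/
theorem exists_dvd_of_prime_pow_dvd {M : ℕ} (hM : M ≠ 0) {g : ℝ → ℕ}
    (hg : ∀ t t', 0 < t → t ≤ t' → g t ∣ g t')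
    (h : ∀ p k : ℕ, p.Prime → p ^ k ∣ M → ∃ t : ℝ, 0 < t ∧ p ^ k ∣ g t) :
    ∃ t : ℝ, 0 < t ∧ M ∣ g t := by
  have h' : ∀ q : ℕ, ∃ t : ℝ, 0 < t ∧ ((∃ p k, p.Prime ∧ q = p ^ k) → q ∣ M → q ∣ g t) := by
    intro q
    by_cases hq : (∃ p k, p.Prime ∧ q = p ^ k) ∧ q ∣ M
    · obtain ⟨⟨p, k, hp, rfl⟩, hqM⟩ := hq
      obtain ⟨t, ht, htq⟩ := h p k hp hqM
      exact ⟨t, ht, fun _ _ => htq⟩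
    · exact ⟨1, one_pos, fun h1 h2 => absurd ⟨h1, h2⟩ hq⟩
  choose τ hτ hτ' using h'
  obtain ⟨T, hT⟩ := (M.divisors.image τ).exists_le
  have hT1 : 0 < T := (hτ 1).trans_le
    (hT _ (Finset.mem_image_of_mem _ (Nat.mem_divisors.2 ⟨one_dvd _, hM⟩)))
  refine ⟨T, hT1, (Nat.dvd_iff_prime_pow_dvd_dvd _ _).2 fun p k hp hpk => ?_⟩
  exact (hτ' _ ⟨p, k, hp, rfl⟩ hpk).trans
    (hg _ _ (hτ _) (hT _ (Finset.mem_image_of_mem _ (Nat.mem_divisors.2 ⟨hpk, hM⟩))))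

theorem le_primeExponent {p : Nat.Primes} {n : ℕ} {s : ℝ} (hs : 0 < s) {x : X}
    (h : (p : ℕ) ^ n ∣ (component s x).ncard) : (n : ℕ∞) ≤ primeExponent X p :=
  le_sSup ⟨n, rfl, x, s, hs, h⟩

theorem exists_pow_dvd_of_le_primeExponent (hh : IsIsometricallyHomogeneous X) (x₀ : X)
    {p : Nat.Primes} {n : ℕ} (h : (n : ℕ∞) ≤ primeExponent X p) :
    ∃ s : ℝ, 0 < s ∧ (p : ℕ) ^ n ∣ (component s x₀).ncard := by
  rcases n with _ | n
  · exact ⟨1, one_pos, by simp⟩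
  · have h1 : (n : ℕ∞) < primeExponent X p := lt_of_lt_of_le (by exact_mod_cast n.lt_succ_self) h
    obtain ⟨_, ⟨m, rfl, x, s, hs, hm⟩, hnm⟩ := lt_sSup_iff.1 h1
    refine ⟨s, hs, ?_⟩
    rw [ncard_component_eq hh x₀ x]
    exact (pow_dvd_pow _ (by exact_mod_cast hnm)).trans hm

end Countable

/-! ### Countable torsion groups with a proper left-invariant metric -/

section Groups

variable {G : Type*} [AddCommGroup G]

theorem finite_closure_of_torsion (hG : ∀ g : G, IsOfFinAddOrder g) {s : Set G} (hs : s.Finite) :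
    Finite (AddSubgroup.closure s) := by
  have : Finite s := hs
  have hfg : AddGroup.FG (AddSubgroup.closure s) := AddGroup.closure_finite_fg s
  refine AddCommGroup.finite_of_fg_isAddTorsion _ fun g => ?_
  have := hG g
  rwa [← AddSubmonoid.isOfFinAddOrder_coe] at *

/-- The group is an increasing union of finite subgroups `H n` with `H 0 = 0`. The index of the
first one containing `x - y` is a left-invariant distance with finite balls. -/
theorem exists_isProperLeftInvariant [Countable G] [Infinite G]
    (hG : ∀ g : G, IsOfFinAddOrder g) : ∃ d : MetricSpace G, IsProperLeftInvariant d := by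
  classical
  obtain ⟨e, he⟩ := exists_surjective_nat G
  let H : ℕ → AddSubgroup G := fun n => AddSubgroup.closure (e '' Set.Iio n)
  have hfin : ∀ n, Finite (H n) := fun n =>
    finite_closure_of_torsion hG ((Set.finite_Iio n).image e)
  have hmono : Monotone H := fun m n h =>
    AddSubgroup.closure_mono (Set.image_mono (Set.Iio_subset_Iio h))
  have hex : ∀ g, ∃ n, g ∈ H n := by
    intro g
    obtain ⟨n, rfl⟩ := he g
    exact ⟨n + 1, AddSubgroup.subset_closure ⟨n, n.lt_succ_self, rfl⟩⟩
  let N : G → ℕ := fun g => Nat.find (hex g)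
  have hN : ∀ g n, N g ≤ n ↔ g ∈ H n := fun g n =>
    ⟨fun h => hmono h (Nat.find_spec (hex g)), fun h => Nat.find_min' _ h⟩
  have hN0 : ∀ g, N g = 0 ↔ g = 0 := by
    intro g
    rw [← Nat.le_zero, hN]
    simp [H]
  have hNneg : ∀ g, N (-g) = N g := fun g =>
    le_antisymm ((hN _ _).2 (neg_mem ((hN _ _).1 le_rfl)))
      ((hN _ _).2 (neg_mem_iff.1 ((hN _ _).1 le_rfl)))
  have hNadd : ∀ g h, N (g + h) ≤ N g + N h := fun g h =>
    (hN _ _).2 (add_mem ((hN _ _).1 (Nat.le_add_right _ _)) ((hN _ _).1 (Nat.le_add_left _ _)))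
  let d : MetricSpace G :=
    { dist := fun x y => N (x - y)
      dist_self := fun x => by
        have : N (x - x) = 0 := (hN0 _).2 (sub_self x)
        exact_mod_cast this
      dist_comm := fun x y => by
        rw [← hNneg (x - y), neg_sub]
      dist_triangle := fun x y z => by
        have := hNadd (x - y) (y - z)
        rw [sub_add_sub_cancel] at this
        exact_mod_cast this
      eq_of_dist_eq_zero := fun {x y} h => by
        have : N (x - y) = 0 := by exact_mod_cast h
        exact sub_eq_zero.1 ((hN0 _).1 this) }
  have hball : ∀ (x : G) (r : ℝ), (Metric.closedBall x r).Finite := by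
    intro x r
    have h1 : ((H ⌊r⌋₊ : Set G)).Finite := Set.toFinite _
    refine (h1.image fun g => g + x).subset fun y hy => ?_
    have h2 : (N (y - x) : ℝ) ≤ r := Metric.mem_closedBall.1 hy
    exact ⟨y - x, (hN _ _).1 (Nat.le_floor h2), sub_add_cancel y x⟩
  refine ⟨d, ⟨fun hb => ?_, fun x r _ => (hball x r).isCompact⟩, fun g x y => ?_⟩
  · obtain ⟨r, hr⟩ := hb.subset_closedBall (0 : G)
    exact Set.infinite_univ ((hball 0 r).subset hr)
  · change (N (g + x - (g + y)) : ℝ) = N (x - y)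
    rw [add_sub_add_left_eq_sub]

variable [d : MetricSpace G]

theorem IsLeftInvariant.isIsometricallyHomogeneous (h : IsLeftInvariant d) :
    IsIsometricallyHomogeneous G := fun x y =>
  ⟨⟨Equiv.addLeft (y - x), Isometry.of_dist_eq fun a b => h (y - x) a b⟩, sub_add_cancel y x⟩

theorem IsLeftInvariant.dist_sub_zero (h : IsLeftInvariant d) (x y : G) :
    dist (x - y) 0 = dist x y := by
  have : dist (y + (x - y)) (y + 0) = dist (x - y) 0 := h y (x - y) 0
  rw [← this]
  simp

theorem IsLeftInvariant.chain_sub_mem (h : IsLeftInvariant d) {s : ℝ} {x y : G}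
    (hxy : chainSetoid G s x y) : x - y ∈ AddSubgroup.closure (Metric.closedBall (0 : G) s) := by
  induction hxy with
  | refl => simp
  | @tail y z _ hyz ih =>
    rw [← sub_add_sub_cancel x y z]
    refine add_mem ih (AddSubgroup.subset_closure ?_)
    rwa [Metric.mem_closedBall, h.dist_sub_zero]

/-- Differences along a `δ`-chain lie in the subgroup generated by the `δ`-ball at 0, which is
finite; small scales are trivial by discreteness. -/
theorem biUniformDimZero_of_torsion [Countable G] (hG : ∀ g : G, IsOfFinAddOrder g)
    (hd : IsProperLeftInvariant d) : BiUniformDimZero G := by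
  obtain ⟨s₀, hs₀, hs⟩ := exists_discrete_scale hd.1 hd.2.isIsometricallyHomogeneous
  constructor
  · intro ε hε
    refine ⟨s₀, hs₀, iSup_le fun x => ?_⟩
    rw [component_of_discrete hs, Metric.ediam_singleton]
    exact zero_le
  · intro δ hδ
    have hball : (Metric.closedBall (0 : G) δ).Finite := by
      obtain ⟨t, -, ht, hcov⟩ := (hd.1.2 0 δ hδ.le).finite_cover_balls hs₀
      refine ht.subset fun x hx => ?_
      obtain ⟨z, hz, hxz⟩ := Set.mem_iUnion₂.1 (hcov hx)
      rwa [hs x z (Metric.mem_ball.1 hxz).le]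
    have := finite_closure_of_torsion hG hball
    obtain ⟨R, hR⟩ := ((Set.toFinite (AddSubgroup.closure (Metric.closedBall (0 : G) δ) :
      Set G)).image fun g => dist g 0).bddAbove
    refine ⟨max R 1, lt_max_of_lt_right one_pos, iSup_le fun x => Metric.ediam_le fun y hy z hz => ?_⟩
    rw [edist_dist]
    refine ENNReal.ofReal_le_ofReal (le_max_of_le_left ?_)
    rw [← hd.2.dist_sub_zero]
    exact hR ⟨y - z, hd.2.chain_sub_mem ((chainSetoid G δ).trans hy ((chainSetoid G δ).symm hz)),
      rfl⟩

theorem IsLeftInvariant.chain_add_left (h : IsLeftInvariant d) {s : ℝ} (g : G) {x y : G}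
    (hxy : chainSetoid G s x y) : chainSetoid G s (g + x) (g + y) :=
  Relation.ReflTransGen.lift (fun x => g + x)
    (fun a b hab => show dist (g + a) (g + b) ≤ s from (h g a b).trans_le hab) _ _ hxy

/-- The component of `0` is a subgroup. -/
def componentSubgroup (h : IsLeftInvariant d) (s : ℝ) : AddSubgroup G where
  carrier := component s 0
  zero_mem' := (chainSetoid G s).refl 0
  add_mem' {x y} hx hy := by
    have := h.chain_add_left x (mem_component.1 hy)
    rw [add_zero] at this
    exact (chainSetoid G s).trans this hx
  neg_mem' {x} hx := by
    have := h.chain_add_left (-x) (mem_component.1 hx)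
    rw [add_zero, neg_add_cancel] at this
    exact (chainSetoid G s).symm this

theorem card_componentSubgroup (h : IsLeftInvariant d) (s : ℝ) :
    Nat.card (componentSubgroup h s) = (component s (0 : G)).ncard :=
  Nat.card_coe_set_eq _

theorem exists_card_dvd_ncard_component (h : IsLeftInvariant d) (K : AddSubgroup G) [Finite K] :
    ∃ s : ℝ, 0 < s ∧ Nat.card K ∣ (component s (0 : G)).ncard := by
  obtain ⟨R, hR⟩ := ((Set.toFinite (K : Set G)).image fun g => dist g 0).bddAbove
  refine ⟨max R 1, lt_max_of_lt_right one_pos, ?_⟩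
  rw [← card_componentSubgroup h]
  exact AddSubgroup.card_dvd_of_le fun g hg =>
    chainSetoid_of_dist_le (le_max_of_le_left (hR ⟨g, hg, rfl⟩))

end Groups

/-! ### The groups `⊕_p (ℤ/p)^{f(p)}` -/

section ZGroup

variable (f : Nat.Primes → ℕ∞)

theorem zGroup_isOfFinAddOrder (g : ZGroup f) : IsOfFinAddOrder g := by
  induction g using DirectSum.induction_on with
  | zero => exact IsOfFinAddOrder.zero
  | of p x =>
    refine isOfFinAddOrder_iff_nsmul_eq_zero.2 ⟨p, p.2.pos, ?_⟩
    rw [← map_nsmul]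
    have : (p : ℕ) • x = 0 := by
      ext i
      simp
    rw [this, map_zero]
  | add x y hx hy => exact hx.add hy

instance : Countable (ZGroup f) :=
  have (p : Nat.Primes) : Countable (ZMod (p : ℕ)) :=
    have : NeZero (p : ℕ) := ⟨p.2.ne_zero⟩
    inferInstance
  inferInstanceAs (Countable (Π₀ p : Nat.Primes, ({k : ℕ // (k : ℕ∞) < f p} →₀ ZMod (p : ℕ))))

variable {f}

theorem exists_subgroup_card_eq_pow {p : Nat.Primes} {n : ℕ} (h : (n : ℕ∞) ≤ f p) :
    ∃ K : AddSubgroup (ZGroup f), Finite K ∧ Nat.card K = (p : ℕ) ^ n := by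
  have : NeZero (p : ℕ) := ⟨p.2.ne_zero⟩
  let ι : Fin n → {k : ℕ // (k : ℕ∞) < f p} := fun i =>
    ⟨i, lt_of_lt_of_le (by exact_mod_cast i.2) h⟩
  have hι : Function.Injective ι := fun i j hij => Fin.ext (congrArg Subtype.val hij)
  let φ : (Fin n →₀ ZMod (p : ℕ)) →+ ZGroup f :=
    (DirectSum.of (fun p : Nat.Primes => ({k : ℕ // (k : ℕ∞) < f p} →₀ ZMod (p : ℕ))) p).comp
      (Finsupp.mapDomain.addMonoidHom ι)
  have hφ : Function.Injective φ :=
    (DirectSum.of_injective (β := fun p : Nat.Primes =>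
      ({k : ℕ // (k : ℕ∞) < f p} →₀ ZMod (p : ℕ))) p).comp (Finsupp.mapDomain_injective hι)
  have : Finite (Fin n →₀ ZMod (p : ℕ)) := Finite.of_equiv _ Finsupp.equivFunOnFinite.symm
  refine ⟨φ.range, Set.finite_range φ, ?_⟩
  rw [← Nat.card_congr (AddMonoidHom.ofInjective hφ).toEquiv,
    Nat.card_congr Finsupp.equivFunOnFinite, Nat.card_fun]
  simp

/-- The projection of `H` to the `p`-part has a kernel of order prime to `p`, by Cauchy's theorem,
so `p ^ n` divides the order of the image and hence `p ^ m`, where `m = f p` is finite. -/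
theorem le_of_pow_dvd_card_subgroup {p : Nat.Primes} {n : ℕ} (H : AddSubgroup (ZGroup f)) [Finite H]
    (h : (p : ℕ) ^ n ∣ Nat.card H) : (n : ℕ∞) ≤ f p := by
  have : Fact (p : ℕ).Prime := ⟨p.2⟩
  rcases eq_or_ne (f p) ⊤ with htop | htop
  · rw [htop]
    exact le_top
  obtain ⟨m, hm⟩ := ENat.ne_top_iff_exists.1 htop
  let φ : H →+ ({k : ℕ // (k : ℕ∞) < f p} →₀ ZMod (p : ℕ)) :=
    (DFinsupp.evalAddMonoidHom p).comp H.subtype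
  have hφ : ∀ x : H, φ x = (x : ZGroup f) p := fun _ => rfl
  have hker : ¬ (p : ℕ) ∣ Nat.card φ.ker := by
    intro hdvd
    obtain ⟨x, hx⟩ := exists_prime_addOrderOf_dvd_card' (G := φ.ker) p hdvd
    have hpx : (p : ℕ) • ((x : H) : ZGroup f) = 0 := by
      have := addOrderOf_nsmul_eq_zero x
      rw [hx] at this
      have := congrArg (fun y : φ.ker => ((y : H) : ZGroup f)) this
      simpa using this
    have hx0 : ((x : H) : ZGroup f) = 0 := by
      refine DFinsupp.ext fun q => ?_
      by_cases hqp : q = p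
      · subst hqp
        exact (hφ _).symm.trans x.2
      · have h1 : (p : ℕ) • ((x : H) : ZGroup f) q = 0 :=
          (DFinsupp.nsmul_apply (p : ℕ) ((x : H) : ZGroup f) q).symm.trans
            (DFunLike.congr_fun hpx q)
        have h2 : (q : ℕ) • ((x : H) : ZGroup f) q = 0 := by
          ext i
          simp
        have hco : Nat.Coprime p q := (Nat.coprime_primes p.2 q.2).2 fun h => hqp (Subtype.ext h.symm)
        have h3 := Nat.dvd_gcd (addOrderOf_dvd_of_nsmul_eq_zero h1)
          (addOrderOf_dvd_of_nsmul_eq_zero h2)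
        rw [Nat.Coprime.gcd_eq_one hco, Nat.dvd_one, AddMonoid.addOrderOf_eq_one_iff] at h3
        exact h3
    have : x = 0 := Subtype.ext (Subtype.ext hx0)
    rw [this, addOrderOf_zero] at hx
    exact p.2.one_lt.ne hx
  have hmul : Nat.card φ.ker * Nat.card φ.range = Nat.card H := by
    rw [← AddSubgroup.index_ker, AddSubgroup.card_mul_index]
  rw [← hmul] at h
  have h1 := (Nat.Coprime.pow_left n ((Nat.Prime.coprime_iff_not_dvd p.2).2 hker)).dvd_of_dvd_mul_left h
  have h2 := h1.trans (AddSubgroup.card_addSubgroup_dvd_card φ.range)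
  have e : {k : ℕ // (k : ℕ∞) < f p} ≃ Fin m :=
    (Equiv.subtypeEquivRight fun k => by rw [← hm]; exact_mod_cast Iff.rfl).trans
      Fin.equivSubtype.symm
  have : Finite {k : ℕ // (k : ℕ∞) < f p} := Finite.of_equiv _ e.symm
  rw [Nat.card_congr Finsupp.equivFunOnFinite, Nat.card_fun, Nat.card_congr e, Nat.card_zmod,
    Nat.card_fin, Nat.pow_dvd_pow_iff_le_right p.2.one_lt] at h2
  rw [← hm]
  exact_mod_cast h2

end ZGroup

/-! ### Comparison of a countable space with its group -/

section Countable

variable {X : Type*} [MetricSpace X] [Countable X] (hp : IsProperUnbounded X)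
  (hh : IsIsometricallyHomogeneous X) (hd : BiUniformDimZero X)

include hp hh hd

/-- If the group were finite, every component cardinality would divide its order, whereas
unboundedness of `X` makes the components arbitrarily large. -/
theorem infinite_zGroup_primeExponent : Infinite (ZGroup (primeExponent X)) := by
  obtain ⟨x₀⟩ := hp.nonempty
  by_contra hfin
  rw [not_infinite_iff_finite] at hfin
  have hle : ∀ s : ℝ, 0 < s → (component s x₀).ncard ≤ Nat.card (ZGroup (primeExponent X)) := by
    intro s hs
    refine Nat.le_of_dvd Nat.card_pos ((Nat.dvd_iff_prime_pow_dvd_dvd _ _).2 fun p k hpr hk => ?_)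
    obtain ⟨K, -, hK⟩ := exists_subgroup_card_eq_pow (le_primeExponent (p := ⟨p, hpr⟩) hs hk)
    have := AddSubgroup.card_addSubgroup_dvd_card K
    rwa [hK] at this
  obtain ⟨s, hs, h⟩ := exists_le_chainIndex_of_le hp hd one_pos x₀
    (Nat.card (ZGroup (primeExponent X)) + 1) 1
  have h1 := ncard_component_mul hh hs x₀ (finite_component hp hh hd (one_pos.trans_le hs) x₀)
  have h2 := hle s (one_pos.trans_le hs)
  have h3 := ncard_component_pos hp hh hd one_pos x₀
  nlinarith

/-- A prime power dividing a component of `X` is the order of a subgroup of the group, which lies in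
some component of 0. Conversely, components of 0 are finite subgroups, whose prime powers are
bounded by `primeExponent X`. -/
theorem biUniformlyEquivalent_zGroup (d : MetricSpace (ZGroup (primeExponent X)))
    (hG : IsProperLeftInvariant d) : BiUniformlyEquivalent X (ZGroup (primeExponent X)) := by
  obtain ⟨x₀⟩ := hp.nonempty
  have hhG := hG.2.isIsometricallyHomogeneous
  have hdG := biUniformDimZero_of_torsion (zGroup_isOfFinAddOrder _) hG
  refine biUniformlyEquivalent_of_dvd hp hh hd hG.1 hhG hdG x₀ 0 (fun s hs => ?_) (fun t ht => ?_)
  · refine exists_dvd_of_prime_pow_dvd (ncard_component_pos hp hh hd hs x₀).ne'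
      (fun t t' ht htt' => ncard_component_dvd hG.1 hhG hdG ht htt' 0) fun p k hpr hk => ?_
    obtain ⟨K, hKfin, hK⟩ := exists_subgroup_card_eq_pow (le_primeExponent (p := ⟨p, hpr⟩) hs hk)
    obtain ⟨t, ht, hdvd⟩ := exists_card_dvd_ncard_component hG.2 K
    rw [hK] at hdvd
    exact ⟨t, ht, hdvd⟩
  · refine exists_dvd_of_prime_pow_dvd (ncard_component_pos hG.1 hhG hdG ht 0).ne'
      (fun t t' ht htt' => ncard_component_dvd hp hh hd ht htt' x₀) fun p k hpr hk => ?_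
    have hfin : Finite (componentSubgroup hG.2 t) := finite_component hG.1 hhG hdG ht 0
    rw [← card_componentSubgroup hG.2] at hk
    exact exists_pow_dvd_of_le_primeExponent hh x₀
      (le_of_pow_dvd_card_subgroup (p := ⟨p, hpr⟩) _ hk)

end Countable

end BiUniform

theorem corollaryt6 {X : Type*} [MetricSpace X]
    (hproper : BiUniform.IsProperUnbounded X)
    (hhom : BiUniform.IsIsometricallyHomogeneous X)
    (hdim : BiUniform.BiUniformDimZero X) :
    (Uncountable X → BiUniform.BiUniformlyEquivalent X BiUniform.CantorBiCube) ∧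
    (Countable X →
      (∃ d : MetricSpace (BiUniform.ZGroup (BiUniform.primeExponent X)),
        BiUniform.IsProperLeftInvariant d) ∧
      ∀ d : MetricSpace (BiUniform.ZGroup (BiUniform.primeExponent X)),
        BiUniform.IsProperLeftInvariant d →
          BiUniform.BiUniformlyEquivalent X
            (BiUniform.ZGroup (BiUniform.primeExponent X))) := by
  refine ⟨fun _ => BiUniform.biUniformlyEquivalent_cantorBiCube hproper hhom hdim, fun _ => ?_⟩
  have := BiUniform.infinite_zGroup_primeExponent hproper hhom hdim
  exact ⟨BiUniform.exists_isProperLeftInvariant (BiUniform.zGroup_isOfFinAddOrder _),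
    fun d hd => BiUniform.biUniformlyEquivalent_zGroup hproper hhom hdim d hd⟩
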